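/- Let $q\ge 2$, let $\mathfrak X$ be the homogeneous tree of degree $q+1$ with reference vertex $o$, distance $d$, $|x|=d(o,x)$, and let $\Omega$ be its boundary, i.e. the set of infinite geodesic rays $\omega=(\omega_0,\omega_1,\dots)$ with $\omega_0=o$. For $\omega\in\Omega$ let $h_\omega(x)=\lim_{m\to\infty}(m-d(x,\omega_m))=2|c(x,\omega)|-|x|$, where $c(x,\omega)$ is the last point of $\omega$ on the geodesic $[o,x]$. Let $\nu$ be the probability measure on $\Omega$ (with the $\sigma$-algebra generated by the sets $E(x)=\{\omega: x\in\omega\}$) with $\nu(E(x))=\frac{1}{(q+1)q^{|x|-1}}$ for $x\ne o$; it is the unique probability measure invariant under the automorphisms fixing $o$. Let $\tau=\pi/\log q$ and let $d\mu(s)=c_P|c(s)|^{-2}ds$ on $[0,\tau]$, where $$c(z)=\frac{q^{1/2}}{q+1}\,\frac{q^{1/2+iz}-q^{-1/2-iz}}{q^{iz}-q^{-iz}},\qquad c_P=\frac{q\log q}{2\pi(q+1)},$$ so that $\mu([0,\tau])=1$. For finitely supported $f$ on $\mathfrak X$ put $\mathcal Hf(\omega,s)=\sum_{y}f(y)q^{(\frac12+is)h_\omega(y)}$,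 and for a measurable $\sigma:\mathfrak X\times\Omega\times[0,\tau]\to\mathbb C$ put $$T_\sigma f(x)=\int_\Omega\int_0^\tau q^{(\frac12-is)h_\omega(x)}\sigma(x,\omega,s)\,\mathcal Hf(\omega,s)\,d\nu(\omega)\,d\mu(s),$$ where it is required that these integrals converge absolutely for all finitely supported $f$ and all $x$. We say that a bounded operator on $L^2(\mathfrak X)$ has symbol $\sigma$ if it agrees with $T_\sigma$ on finitely supported functions. **Theorem.** Let $\sigma$ be measurable and suppose that $T_\sigma$ extends to a nuclear operator $T_\sigma:L^2(\mathfrak X)\to L^2(\mathfrak X)$, i.e. there are $x_n'\in L^2(\mathfrak X)'$ and $y_n\in L^2(\mathfrak X)$ with $\sum_n\|x_n'\|\|y_n\|<\infty$ and $T_\sigma f=\sum_n x_n'(f)y_n$ for all $f$. Then the adjoint $T_\sigma^*$ has a measurable symbol, and a measurable function $\sigma^*$ on $\mathfrak X\times\Omega\times[0,\tau]$ is a symbol of $T_\sigma^*$ if and only if for every $y\in\mathfrak X$ $$\sigma^*(y,\omega_1,s_1)=q^{-(\frac12-is_1)h_{\omega_1}(y)}\sum_{x\in\mathfrak X}q^{(\frac12-is_1)h_{\omega_1}(x)}\int_\Omega\int_0^\tau\overline{\sigma(x,\omega,s)}\,q^{(\frac12+is)h_\omega(x)}\,q^{(\frac12-is)h_\omega(y)}\,d\nu(\omega)\,d\mu(s),$$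 where the sum over $x$ converges unconditionally in $L^2(\Omega\times[0,\tau],\nu\otimes\mu)$ as a series of functions of $(\omega_1,s_1)$, and the equality is equality in that space (so it holds for almost every $(\omega_1,s_1)$). In particular the symbol of $T_\sigma^*$ is unique up to null sets. -/

import Mathlib

open MeasureTheory

noncomputable section

namespace HomTree

variable {V : Type*}

/-- `G` is a homogeneous tree of degree `q + 1`: connected, without cycles, and every vertex has
exactly `q + 1` neighbours. -/
structure IsHomogeneousTree (G : SimpleGraph V) (q : ℕ) : Prop where
  isTree : G.IsTree
  ncard_neighborSet : ∀ v, (G.neighborSet v).ncard = q + 1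

/-- The boundary of the tree: the infinite geodesic rays starting at `o`. -/
structure Boundary (G : SimpleGraph V) (o : V) where
  ray : ℕ → V
  ray_zero : ray 0 = o
  geodesic : ∀ m k, G.dist (ray m) (ray (m + k)) = k

variable {G : SimpleGraph V} {o : V}

/-- The level `|c(x, ω)|` of the confluence point: the last index `n` for which `ω_n` lies on the
geodesic path `[o, x]`. -/
def confluenceLevel (ω : Boundary G o) (x : V) : ℕ :=
  sSup {n | G.dist o (ω.ray n) + G.dist (ω.ray n) x = G.dist o x}

/-- The height function `h_ω(x) = 2 |c(x, ω)| - |x|`. -/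
def height (ω : Boundary G o) (x : V) : ℤ :=
  2 * (confluenceLevel ω x : ℤ) - (G.dist o x : ℤ)

/-- `E(x)`: the rays `ω` with `|c(x, ω)| = |x|`, that is, the rays through `x`. -/
def shadow (G : SimpleGraph V) (o : V) (x : V) : Set (Boundary G o) :=
  {ω | confluenceLevel ω x = G.dist o x}

/-- The σ-algebra on the boundary generated by the sets `E(x)`. -/
instance : MeasurableSpace (Boundary G o) :=
  MeasurableSpace.generateFrom (Set.range (shadow G o))

/-- The neighbours of `v` that are farther from `o` than `v`. -/
def children (G : SimpleGraph V) (o v : V) : Set V :=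
  {w | G.Adj v w ∧ G.dist o w = G.dist o v + 1}

open Classical in
/-- The uniform distribution on the children of `v`. (In a homogeneous tree of degree at least two,
the set of children is finite and nonempty, and the second case does not occur.) -/
def stepMeasure (G : SimpleGraph V) (o v : V) : @Measure V ⊤ :=
  letI : MeasurableSpace V := ⊤
  if (children G o v).Finite ∧ (children G o v).Nonempty then
    ProbabilityTheory.uniformOn (children G o v)
  else Measure.dirac v

instance (v : V) : @IsProbabilityMeasure V ⊤ (stepMeasure G o v) := by
  let _ : MeasurableSpace V := ⊤
  unfold stepMeasure
  split_ifs with h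
  · exact ProbabilityTheory.isProbabilityMeasure_uniformOn h.1 h.2
  · exact Measure.dirac.isProbabilityMeasure

/-- The probability measure `ν` on the boundary that is invariant under all automorphisms fixing
`o`: choose, independently for every vertex `v`, a uniformly distributed child `c v` of `v`; then
`ν` is the law of the random ray `o, c o, c (c o), …`. Thus
`ν (E(x)) = 1 / ((q + 1) * q ^ (|x| - 1))` for every vertex `x ≠ o`. -/
def boundaryMeasure (G : SimpleGraph V) (o : V) : Measure (Boundary G o) :=
  letI : MeasurableSpace V := ⊤
  ((Measure.infinitePi (stepMeasure G o)).map (fun (c : V → V) (n : ℕ) => c^[n] o)).comap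
    Boundary.ray

/-- `τ = π / log q`. -/
def tau (q : ℕ) : ℝ := Real.pi / Real.log q

/-- The function `c(z)` of the Plancherel density. -/
def cFun (q : ℕ) (z : ℂ) : ℂ :=
  (q : ℂ) ^ (1 / 2 : ℂ) / ((q : ℂ) + 1) *
    (((q : ℂ) ^ (1 / 2 + Complex.I * z) - (q : ℂ) ^ (-(1 / 2) - Complex.I * z)) /
      ((q : ℂ) ^ (Complex.I * z) - (q : ℂ) ^ (-(Complex.I * z))))

/-- The constant of the Plancherel measure; it makes the total mass of the Plancherel measure on
`[0, τ]` equal to one. -/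
def cP (q : ℕ) : ℝ := q * Real.log q / (2 * Real.pi * (q + 1))

/-- The Plancherel measure `dμ(s) = c_P |c(s)|⁻² ds` on `[0, τ]`. -/
def plancherel (q : ℕ) : Measure (Set.Icc (0 : ℝ) (tau q)) :=
  ((volume : Measure ℝ).comap Subtype.val).withDensity
    (fun s => ENNReal.ofReal (cP q * (‖cFun q ((s : ℝ) : ℂ)‖ ^ 2)⁻¹))

/-- The space `Ω × [0, τ]` of the spectral variables `(ω, s)`. -/
abbrev Phase (G : SimpleGraph V) (o : V) (q : ℕ) : Type _ :=
  Boundary G o × Set.Icc (0 : ℝ) (tau q)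

/-- The measure `ν ⊗ μ` on `Ω × [0, τ]`. -/
def phaseMeasure (G : SimpleGraph V) (o : V) (q : ℕ) : Measure (Phase G o q) :=
  (boundaryMeasure G o).prod (plancherel q)

/-- `q ^ ((1/2 + i s) h_ω(x))`. -/
def wavePlus {q : ℕ} (p : Phase G o q) (x : V) : ℂ :=
  (q : ℂ) ^ ((1 / 2 + Complex.I * ((p.2 : ℝ) : ℂ)) * (height p.1 x : ℂ))

/-- `q ^ ((1/2 - i s) h_ω(x))`. -/
def waveMinus {q : ℕ} (p : Phase G o q) (x : V) : ℂ :=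
  (q : ℂ) ^ ((1 / 2 - Complex.I * ((p.2 : ℝ) : ℂ)) * (height p.1 x : ℂ))

/-- The Fourier-Helgason transform of a finitely supported function. -/
def helgason {q : ℕ} (f : V → ℂ) (p : Phase G o q) : ℂ :=
  ∑ᶠ y, f y * wavePlus p y

/-- `L²(𝔛)` for the counting measure. -/
abbrev L2 (V : Type*) : Type _ := lp (fun _ : V => ℂ) 2

/-- `T` is the bounded extension to `L²(𝔛)` of the pseudo-differential operator with symbol `σ`:
for finitely supported `f` the integral that defines `T_σ f (x)` exists and equals `(T f) (x)`. -/
def IsPseudoDiff {q : ℕ} (σ : V → Phase G o q → ℂ) (T : L2 V →L[ℂ] L2 V) : Prop :=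
  ∀ f : L2 V, (Function.support (f : V → ℂ)).Finite → ∀ x : V,
    Integrable (fun p => waveMinus p x * σ x p * helgason (f : V → ℂ) p) (phaseMeasure G o q) ∧
    T f x = ∫ p, waveMinus p x * σ x p * helgason (f : V → ℂ) p ∂(phaseMeasure G o q)

/-- Nuclear operators between Banach spaces. -/
def IsNuclear {X Y : Type*} [NormedAddCommGroup X] [NormedSpace ℂ X] [NormedAddCommGroup Y]
    [NormedSpace ℂ Y] (T : X →L[ℂ] Y) : Prop :=
  ∃ (x' : ℕ → X →L[ℂ] ℂ) (y : ℕ → Y), Summable (fun n => ‖x' n‖ * ‖y n‖) ∧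
    ∀ x, HasSum (fun n => x' n x • y n) (T x)

end HomTree

end

/-! Write `e_x` for `waveMinus · x`; its complex conjugate is `wavePlus · x`. Tested on unit
vectors, `σ'` is a symbol of `S` exactly when, for each `y`, the function `e_y σ'(y, ·)` is
integrable against all waves and has coefficients `(S δ_x)(y)` with respect to the `e_x`. For `S =
T*` these are the conjugates of `(T δ_y)(x)`, hence square summable in `x`. Two facts about the
waves then suffice.

Orthonormality in `L²(Ω × [0, τ])`: integrating over the boundary gives a spherical function. Times
the Plancherel density it becomes, up to a constant, `H(u) + H(ū)` with `u = q^(1/2 + is)` and `H`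
holomorphic near the disc `|u| ≤ √q`, so the mean value property evaluates the integral
(`integral_density_mul`). Hence the series with these coefficients converges unconditionally to some
`g_y`, and `e_y⁻¹ g_y` is a symbol.

Totality in the `L¹` sense: an integrable function that annihilates every wave is null
(`Annihilates.ae_eq_zero`). The annihilator is stable under multiplication by the adjacency
eigenvalue, hence under all continuous functions of `s`; a combination of the waves at a vertex and
its parent then isolates the indicator of `E(x)`. This gives uniqueness, and since `e_y` and its
inverse are bounded, `σ'(y, ·)` must be the limit of the divided series. -/

noncomputable section

namespace HomTree

variable {V : Type*} {G : SimpleGraph V} {o : V} {q : ℕ}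

/-! ### Parents and geodesics in a tree -/

section Tree

/-- In a tree, the neighbour of `v` that is closer to `r` is unique. -/
theorem eq_of_adj_of_dist_add_one (hT : G.IsTree) {r v u u' : V} (hu : G.Adj v u)
    (hu' : G.Adj v u') (h : G.dist u r + 1 = G.dist v r) (h' : G.dist u' r + 1 = G.dist v r) :
    u = u' := by
  obtain ⟨p, hp⟩ := hT.connected.exists_walk_length_eq_dist u r
  obtain ⟨p', hp'⟩ := hT.connected.exists_walk_length_eq_dist u' r
  have key : (SimpleGraph.Walk.cons hu p) = SimpleGraph.Walk.cons hu' p' := by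
    refine (hT.existsUnique_path v r).unique ?_ ?_
    · exact SimpleGraph.Walk.isPath_of_length_eq_dist _ (by simp [hp, h])
    · exact SimpleGraph.Walk.isPath_of_length_eq_dist _ (by simp [hp', h'])
  have := congrArg SimpleGraph.Walk.snd key
  simpa using this

theorem dist_or_of_adj (hT : G.IsTree) {v u : V} (r : V) (hu : G.Adj v u) :
    G.dist u r + 1 = G.dist v r ∨ G.dist u r = G.dist v r + 1 := by
  have := hT.dist_eq_dist_add_one_of_adj r hu
  rw [G.dist_comm (u := r) (v := u), G.dist_comm (u := r) (v := v)] at this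
  omega

theorem exists_adj_dist_add_one (hT : G.IsTree) {r v : V} (h : v ≠ r) :
    ∃ u, G.Adj v u ∧ G.dist u r + 1 = G.dist v r := by
  obtain ⟨p, hp⟩ := hT.connected.exists_walk_length_eq_dist v r
  cases p with
  | nil => exact absurd rfl h
  | cons hu p =>
    rename_i u
    refine ⟨u, hu, ?_⟩
    have h1 := G.dist_le p
    have h2 := dist_or_of_adj hT r hu
    simp at hp
    omega

/-- A geodesic that starts with a step away from `o` keeps moving away from `o`. -/
theorem dist_eq_add_of_child (hT : G.IsTree) {x u y : V} (hu : G.Adj x u)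
    (ho : G.dist u o = G.dist x o + 1) (hy : G.dist u y + 1 = G.dist x y) :
    G.dist y o = G.dist x o + G.dist x y := by
  induction hn : G.dist u y generalizing x u with
  | zero =>
    have : u = y := (hT.connected.dist_eq_zero_iff).1 hn
    subst this
    omega
  | succ n ih =>
    have hne : u ≠ y := by rintro rfl; simp at hn
    obtain ⟨u', hu', h'⟩ := exists_adj_dist_add_one hT hne
    have hx : u' ≠ x := by rintro rfl; omega
    have h2 : G.dist u' o = G.dist u o + 1 := by
      -- If `u'` were closer to `o` than `u`, it would be the parent `x` of `u`; but `u'` is nearer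
      -- to `y` than `u` is, and `x` is farther.
      rcases dist_or_of_adj hT o hu' with h | h
      · exact absurd (eq_of_adj_of_dist_add_one hT hu' hu.symm h ho.symm) hx
      · exact h
    have := ih hu' h2 h' (by omega)
    omega

/-- If `y` is not farther from `o` than `x`, the geodesic from `x` to `y` passes through the
parent of `x`. -/
theorem dist_parent_add_one (hT : G.IsTree) {x v y : V} (hv : G.Adj v x)
    (ho : G.dist o x = G.dist o v + 1) (hle : G.dist o y ≤ G.dist o x) (hne : y ≠ x) :
    G.dist v y + 1 = G.dist x y := by
  rw [G.dist_comm (u := o), G.dist_comm (u := o)] at ho hle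
  obtain ⟨u, hu, h⟩ := exists_adj_dist_add_one hT hne.symm
  rcases dist_or_of_adj hT o hu with h' | h'
  · rwa [← eq_of_adj_of_dist_add_one hT hu hv.symm h' ho.symm]
  · have := dist_eq_add_of_child hT hu h' h
    omega

theorem exists_parent (hT : G.IsTree) {x : V} (hx : x ≠ o) :
    ∃ v, G.Adj v x ∧ G.dist o x = G.dist o v + 1 := by
  obtain ⟨v, hv, h⟩ := exists_adj_dist_add_one hT hx
  exact ⟨v, hv.symm, by rw [G.dist_comm (u := o), G.dist_comm (u := o), h]⟩

theorem parent_unique (hT : G.IsTree) {x v v' : V} (hv : G.Adj v x)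
    (ho : G.dist o x = G.dist o v + 1) (hv' : G.Adj v' x)
    (ho' : G.dist o x = G.dist o v' + 1) : v = v' :=
  eq_of_adj_of_dist_add_one hT (r := o) hv.symm hv'.symm
    (by rw [G.dist_comm (v := o), G.dist_comm (v := o), ho])
    (by rw [G.dist_comm (v := o), G.dist_comm (v := o), ho'])

end Tree

/-! ### Boundary rays, confluence points and heights -/

section Rays

theorem Boundary.ext {ω ω' : Boundary G o} (h : ω.ray = ω'.ray) : ω = ω' := by
  cases ω; cases ω'; simpa using h

theorem dist_ray (ω : Boundary G o) (n : ℕ) : G.dist o (ω.ray n) = n := by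
  have := ω.geodesic 0 n
  rwa [ω.ray_zero, zero_add] at this

theorem adj_ray (ω : Boundary G o) (n : ℕ) : G.Adj (ω.ray n) (ω.ray (n + 1)) :=
  SimpleGraph.dist_eq_one_iff_adj.1 (ω.geodesic n 1)

theorem ray_ne (ω : Boundary G o) (n : ℕ) : ω.ray (n + 2) ≠ ω.ray n := by
  intro h
  have := ω.geodesic n 2
  rw [h] at this
  simp at this

theorem ray_eq_of_le (hT : G.IsTree) {ω ω' : Boundary G o} {m n : ℕ} (hmn : m ≤ n)
    (h : ω.ray n = ω'.ray n) : ω.ray m = ω'.ray m := by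
  induction n, hmn using Nat.le_induction with
  | base => exact h
  | succ n _ ih =>
    refine ih (parent_unique (o := o) hT (adj_ray ω n) (by simp [dist_ray]) (h ▸ adj_ray ω' n) ?_)
    rw [h, dist_ray, dist_ray]

/-- The confluence point lies on the geodesic from `o` to `x`. -/
theorem dist_ray_confluenceLevel (ω : Boundary G o) (x : V) :
    confluenceLevel ω x + G.dist (ω.ray (confluenceLevel ω x)) x = G.dist o x := by
  have h0 : (0 : ℕ) ∈ {n | G.dist o (ω.ray n) + G.dist (ω.ray n) x = G.dist o x} := by
    simp [ω.ray_zero]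
  have hb : BddAbove {n | G.dist o (ω.ray n) + G.dist (ω.ray n) x = G.dist o x} := by
    refine ⟨G.dist o x, fun n hn => ?_⟩
    simp only [Set.mem_ofPred_eq, dist_ray] at hn
    omega
  have h : confluenceLevel ω x ∈ {n | G.dist o (ω.ray n) + G.dist (ω.ray n) x = G.dist o x} :=
    Nat.sSup_mem ⟨0, h0⟩ hb
  simpa only [Set.mem_ofPred_eq, dist_ray] using h

theorem le_confluenceLevel (ω : Boundary G o) {x : V} {n : ℕ}
    (h : n + G.dist (ω.ray n) x = G.dist o x) : n ≤ confluenceLevel ω x := by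
  refine le_csSup ⟨G.dist o x, fun n hn => ?_⟩ (by simpa [dist_ray] using h)
  simp only [Set.mem_ofPred_eq, dist_ray] at hn
  omega

/-- Beyond the confluence point the ray recedes from `x`: the first step by maximality of the level,
each later one because the only neighbour closer to `x` is the previous vertex of the ray, and a ray
does not turn back. -/
theorem dist_ray_confluenceLevel_add (hT : G.IsTree) (ω : Boundary G o) (x : V) (k : ℕ) :
    G.dist (ω.ray (confluenceLevel ω x + k)) x =
      G.dist (ω.ray (confluenceLevel ω x)) x + k := by
  induction k using Nat.strong_induction_on with
  | _ k ih =>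
    match k with
    | 0 => rfl
    | 1 =>
      rcases dist_or_of_adj hT x (adj_ray ω (confluenceLevel ω x)) with h | h
      · have h1 := dist_ray_confluenceLevel ω x
        have := le_confluenceLevel ω (x := x) (n := confluenceLevel ω x + 1) (by omega)
        omega
      · exact h
    | k + 2 =>
      have h0 := ih k (by omega)
      have h1 := ih (k + 1) (by omega)
      rcases dist_or_of_adj hT x (adj_ray ω (confluenceLevel ω x + (k + 1))) with h | h
      · refine absurd (eq_of_adj_of_dist_add_one hT (adj_ray ω (confluenceLevel ω x + (k + 1)))
          (adj_ray ω (confluenceLevel ω x + k)).symm h ?_) (ray_ne ω _)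
        rw [h0, add_assoc, ← h1]
      · rw [show confluenceLevel ω x + (k + 2) = confluenceLevel ω x + (k + 1) + 1 by ring, h, h1]
        ring

/-- The height is a Busemann function. -/
theorem height_eq (hT : G.IsTree) (ω : Boundary G o) {x : V} {m : ℕ} (hm : G.dist o x ≤ m) :
    height ω x = m - G.dist (ω.ray m) x := by
  have h1 := dist_ray_confluenceLevel ω x
  obtain ⟨k, rfl⟩ := Nat.exists_eq_add_of_le (show confluenceLevel ω x ≤ m by omega)
  rw [dist_ray_confluenceLevel_add hT, height]
  push_cast
  omega

theorem mem_shadow (hT : G.IsTree) {ω : Boundary G o} {x : V} :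
    ω ∈ shadow G o x ↔ ω.ray (G.dist o x) = x := by
  constructor
  · intro h
    have h1 := dist_ray_confluenceLevel ω x
    rw [show confluenceLevel ω x = G.dist o x from h] at h1
    exact hT.connected.dist_eq_zero_iff.1 (by omega)
  · intro h
    have h1 := dist_ray_confluenceLevel ω x
    have h2 := le_confluenceLevel ω (x := x) (n := G.dist o x) (by simp [h])
    show confluenceLevel ω x = G.dist o x
    omega

theorem shadow_root (hT : G.IsTree) : shadow G o o = Set.univ := by
  ext ω
  simp [mem_shadow hT, ω.ray_zero]

theorem height_root (hT : G.IsTree) (ω : Boundary G o) : height ω o = 0 := by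
  simp [height_eq hT ω (x := o) (m := 0) (by simp), ω.ray_zero]

theorem abs_height_le (ω : Boundary G o) (x : V) : |height ω x| ≤ G.dist o x := by
  have h1 := dist_ray_confluenceLevel ω x
  rw [height, abs_le]
  omega

/-- The value does not depend on `ω`: powers of the height of `y` are constant on `E(x)` and can be
pulled out of integrals over it. -/
theorem height_of_mem_shadow (hT : G.IsTree) {ω : Boundary G o} {x y : V}
    (hω : ω ∈ shadow G o x) (hle : G.dist o y ≤ G.dist o x) :
    height ω y = G.dist o x - G.dist x y := by
  rw [height_eq hT ω hle, (mem_shadow hT).1 hω]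

/-- The geodesic from `w` to the vertex of the ray at the level of `w` starts with the step to the
parent `v`. -/
theorem height_child_of_notMem (hT : G.IsTree) {ω : Boundary G o} {v w : V} (hv : G.Adj v w)
    (ho : G.dist o w = G.dist o v + 1) (hω : ω ∉ shadow G o w) :
    height ω w = height ω v - 1 := by
  rw [mem_shadow hT] at hω
  rw [height_eq hT ω le_rfl, height_eq hT ω (show G.dist o v ≤ G.dist o w by omega)]
  have := dist_parent_add_one hT hv ho (dist_ray ω _).le hω
  rw [G.dist_comm (u := v), G.dist_comm (u := w)] at this
  omega

theorem height_self_of_mem (hT : G.IsTree) {ω : Boundary G o} {w : V} (hω : ω ∈ shadow G o w) :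
    height ω w = G.dist o w := by
  simp [height_of_mem_shadow hT hω le_rfl]

theorem height_parent_of_mem (hT : G.IsTree) {ω : Boundary G o} {v w : V} (hv : G.Adj v w)
    (ho : G.dist o w = G.dist o v + 1) (hω : ω ∈ shadow G o w) :
    height ω v = G.dist o v := by
  rw [height_of_mem_shadow hT hω (by omega), SimpleGraph.dist_eq_one_iff_adj.2 hv.symm]
  omega

/-- Exactly one neighbour of `v` lies above `v`, the others lie below. -/
theorem exists_height_neighbor (hT : G.IsTree) (ω : Boundary G o) (v : V) :
    ∃ u, G.Adj v u ∧ height ω u = height ω v + 1 ∧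
      ∀ u', G.Adj v u' → u' ≠ u → height ω u' = height ω v - 1 := by
  -- The level `|v| + 1` is large enough to read off the heights of `v` and of all its neighbours
  -- from the single vertex `ω_m`.
  set m := G.dist o v + 1 with hm
  have hne : v ≠ ω.ray m := by
    intro h
    have := dist_ray ω m
    rw [← h] at this
    omega
  have hh : ∀ u, G.Adj v u → height ω u = m - G.dist u (ω.ray m) := by
    intro u hu
    rw [height_eq hT ω (m := m), G.dist_comm]
    have := dist_or_of_adj hT o hu
    rw [G.dist_comm (v := o), G.dist_comm (v := o)] at this
    omega
  have hv : height ω v = m - G.dist v (ω.ray m) := by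
    rw [height_eq hT ω (m := m) (by omega), G.dist_comm]
  obtain ⟨u, hu, h⟩ := exists_adj_dist_add_one hT hne
  refine ⟨u, hu, by rw [hh u hu, hv]; omega, fun u' hu' hne' => ?_⟩
  rcases dist_or_of_adj hT (ω.ray m) hu' with h' | h'
  · exact absurd (eq_of_adj_of_dist_add_one hT hu' hu h' h) hne'
  · rw [hh u' hu', hv]; omega

end Rays

/-! ### Numbers of children and countability of the tree -/

section Count

theorem IsHomogeneousTree.finite_neighborSet (hG : IsHomogeneousTree G q) (v : V) :
    (G.neighborSet v).Finite :=
  Set.finite_of_ncard_ne_zero (by rw [hG.ncard_neighborSet]; omega)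

theorem finite_children (hG : IsHomogeneousTree G q) (v : V) : (children G o v).Finite :=
  (hG.finite_neighborSet v).subset fun _ hw => hw.1

theorem ncard_children_root (hG : IsHomogeneousTree G q) : (children G o o).ncard = q + 1 := by
  rw [← hG.ncard_neighborSet o]
  congr 1
  ext w
  simp only [children, Set.mem_ofPred_eq, SimpleGraph.mem_neighborSet, and_iff_left_iff_imp]
  intro h
  simp [SimpleGraph.dist_eq_one_iff_adj.2 h]

theorem ncard_children_of_ne (hG : IsHomogeneousTree G q) {v : V} (hv : v ≠ o) :
    (children G o v).ncard = q := by
  obtain ⟨p, hp, hpo⟩ := exists_parent hG.isTree hv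
  have : children G o v = G.neighborSet v \ {p} := by
    ext w
    simp only [children, Set.mem_ofPred_eq, SimpleGraph.mem_neighborSet, Set.mem_sdiff,
      Set.mem_singleton_iff]
    refine and_congr_right fun hw => ⟨?_, fun hne => ?_⟩
    · rintro h rfl
      omega
    · have h := dist_or_of_adj hG.isTree o hw
      rw [G.dist_comm (v := o), G.dist_comm (v := o)] at h
      refine h.resolve_left fun h => hne ?_
      exact parent_unique (o := o) hG.isTree hw.symm h.symm hp hpo
  rw [this, Set.ncard_sdiff_singleton_of_mem (by simpa using hp.symm), hG.ncard_neighborSet]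
  rfl

theorem ncard_children_pos (hq : 2 ≤ q) (hG : IsHomogeneousTree G q) (v : V) :
    0 < (children G o v).ncard := by
  by_cases hv : v = o
  · subst hv; rw [ncard_children_root hG]; omega
  · rw [ncard_children_of_ne hG hv]; omega

theorem nonempty_children (hq : 2 ≤ q) (hG : IsHomogeneousTree G q) (v : V) :
    (children G o v).Nonempty :=
  Set.nonempty_of_ncard_ne_zero (ncard_children_pos hq hG v).ne'

/-- Spheres around `o` are finite by induction along parents. Countability is what makes the
discrete σ-algebra on `V` manageable, also on products. -/
theorem countable_vertices (o : V) (hG : IsHomogeneousTree G q) : Countable V := by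
  have hfin : ∀ n, {v | G.dist o v = n}.Finite := by
    intro n
    induction n with
    | zero =>
      refine (Set.finite_singleton o).subset fun v hv => ?_
      exact (hG.isTree.connected.dist_eq_zero_iff.1 hv).symm
    | succ n ih =>
      refine (ih.biUnion fun v _ => finite_children (o := o) hG v).subset fun w hw => ?_
      have hw' : G.dist o w = n + 1 := hw
      obtain ⟨v, hv, h⟩ := exists_parent (o := o) (x := w) hG.isTree
        (by rintro rfl; simp at hw')
      simp only [Set.mem_iUnion]
      exact ⟨v, show G.dist o v = n by omega, hv, h⟩
  have : (Set.univ : Set V) = ⋃ n, {v | G.dist o v = n} := by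
    ext v
    simp
  rw [← Set.countable_univ_iff, this]
  exact Set.countable_iUnion fun n => (hfin n).countable

end Count

/-! ### Measurable structure of the boundary -/

section Measurability

theorem measurable_ray_apply (hG : IsHomogeneousTree G q) (n : ℕ) :
    @Measurable _ _ _ ⊤ (fun ω : Boundary G o => ω.ray n) := by
  have := countable_vertices o hG
  let _ : MeasurableSpace V := ⊤
  refine measurable_to_countable' fun v => ?_
  by_cases hv : G.dist o v = n
  · have : (fun ω : Boundary G o => ω.ray n) ⁻¹' {v} = shadow G o v := by
      ext ω
      rw [mem_shadow hG.isTree, hv]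
      rfl
    rw [this]
    exact MeasurableSpace.measurableSet_generateFrom ⟨v, rfl⟩
  · have : (fun ω : Boundary G o => ω.ray n) ⁻¹' {v} = ∅ := by
      ext ω
      simp only [Set.mem_preimage, Set.mem_singleton_iff, Set.mem_empty_iff_false, iff_false]
      rintro rfl
      exact hv (dist_ray ω n)
    rw [this]
    exact MeasurableSet.empty

theorem measurableSet_shadow (x : V) : MeasurableSet (shadow G o x) :=
  MeasurableSpace.measurableSet_generateFrom ⟨x, rfl⟩

theorem measurable_height (hG : IsHomogeneousTree G q) (x : V) :
    Measurable (fun ω : Boundary G o => height ω x) := by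
  let _ : MeasurableSpace V := ⊤
  have : (fun ω : Boundary G o => height ω x) =
      (fun v : V => (G.dist o x : ℤ) - G.dist v x) ∘ fun ω => ω.ray (G.dist o x) := by
    ext ω
    exact height_eq hG.isTree ω le_rfl
  rw [this]
  exact Measurable.comp (fun _ _ => trivial) (measurable_ray_apply hG _)

theorem range_ray : Set.range (Boundary.ray : Boundary G o → ℕ → V) =
    (fun r => r 0) ⁻¹' {o} ∩
      ⋂ (m : ℕ) (k : ℕ), (fun r => (r m, r (m + k))) ⁻¹' {p | G.dist p.1 p.2 = k} := by
  ext r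
  simp only [Set.mem_range, Set.mem_inter_iff, Set.mem_preimage, Set.mem_singleton_iff,
    Set.mem_ofPred_eq, Set.mem_iInter]
  constructor
  · rintro ⟨ω, rfl⟩
    exact ⟨ω.ray_zero, ω.geodesic⟩
  · rintro ⟨h0, h⟩
    exact ⟨⟨r, h0, h⟩, rfl⟩

/-- Needed to evaluate the `comap` in `boundaryMeasure`. Being a geodesic from `o` is a countable
set of coordinate conditions, and each `E(x)` is the preimage of a cylinder. -/
theorem measurableEmbedding_ray (hG : IsHomogeneousTree G q) :
    letI : MeasurableSpace V := ⊤
    MeasurableEmbedding (Boundary.ray : Boundary G o → ℕ → V) := by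
  have := countable_vertices o hG
  let _ : MeasurableSpace V := ⊤
  have hmeas : Measurable (Boundary.ray : Boundary G o → ℕ → V) :=
    measurable_pi_iff.2 fun n => measurable_ray_apply hG n
  have hR : MeasurableSet (Set.range (Boundary.ray : Boundary G o → ℕ → V)) := by
    rw [range_ray]
    refine ((measurable_pi_apply 0) (measurableSet_singleton o)).inter
      (MeasurableSet.iInter fun m => MeasurableSet.iInter fun k => ?_)
    exact ((measurable_pi_apply m).prodMk (measurable_pi_apply (m + k)))
      (Set.to_countable {p : V × V | G.dist p.1 p.2 = k}).measurableSet
  refine ⟨fun ω ω' h => Boundary.ext h, hmeas, fun {s} hs => ?_⟩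
  have hle : MeasurableSpace.generateFrom (Set.range (shadow G o)) ≤
      MeasurableSpace.comap (Boundary.ray : Boundary G o → ℕ → V) MeasurableSpace.pi := by
    refine MeasurableSpace.generateFrom_le ?_
    rintro _ ⟨x, rfl⟩
    refine ⟨(fun r => r (G.dist o x)) ⁻¹' {x},
      (measurable_pi_apply _) (measurableSet_singleton x), ?_⟩
    ext ω
    exact (mem_shadow hG.isTree).symm
  obtain ⟨t, ht, rfl⟩ := hle s hs
  rw [Set.image_preimage_eq_inter_range]
  exact ht.inter hR

end Measurability

/-! ### The measure of the sets `E(x)` -/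

section BoundaryMeasure

/-- Children maps: every vertex is sent to one of its children. -/
def IsChildMap (G : SimpleGraph V) (o : V) (c : V → V) : Prop :=
  ∀ v, c v ∈ children G o v

theorem IsChildMap.dist_iterate {c : V → V} (hc : IsChildMap G o c) (n : ℕ) :
    G.dist o (c^[n] o) = n := by
  induction n with
  | zero => simp
  | succ n ih => rw [Function.iterate_succ_apply', (hc _).2, ih]

theorem IsChildMap.dist_iterate_add_le (hG : IsHomogeneousTree G q) {c : V → V}
    (hc : IsChildMap G o c) (m k : ℕ) : G.dist (c^[m] o) (c^[m + k] o) ≤ k := by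
  induction k with
  | zero => simp
  | succ k ih =>
    have h := hG.isTree.connected.dist_triangle (u := c^[m] o) (v := c^[m + k] o)
      (w := c^[m + (k + 1)] o)
    rw [← add_assoc, Function.iterate_succ_apply'] at *
    rw [SimpleGraph.dist_eq_one_iff_adj.2 (hc (c^[m + k] o)).1] at h
    omega

/-- The ray through `o, c o, c (c o), …`. -/
def IsChildMap.ray (hG : IsHomogeneousTree G q) {c : V → V} (hc : IsChildMap G o c) :
    Boundary G o where
  ray n := c^[n] o
  ray_zero := rfl
  geodesic m k := by
    have h1 := hc.dist_iterate_add_le hG m k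
    have h2 := hG.isTree.connected.dist_triangle (u := o) (v := c^[m] o) (w := c^[m + k] o)
    rw [hc.dist_iterate, hc.dist_iterate] at h2
    omega

theorem stepMeasure_children (hq : 2 ≤ q) (hG : IsHomogeneousTree G q) (v : V) :
    stepMeasure G o v (children G o v) = 1 := by
  let _ : MeasurableSpace V := ⊤
  rw [stepMeasure, if_pos ⟨finite_children hG v, nonempty_children hq hG v⟩]
  exact ProbabilityTheory.uniformOn_self (finite_children hG v) (nonempty_children hq hG v)

theorem stepMeasure_singleton (hq : 2 ≤ q) (hG : IsHomogeneousTree G q) {v w : V}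
    (hw : w ∈ children G o v) :
    stepMeasure G o v {w} = ((children G o v).ncard : ENNReal)⁻¹ := by
  classical
  let _ : MeasurableSpace V := ⊤
  rw [stepMeasure, if_pos ⟨finite_children hG v, nonempty_children hq hG v⟩]
  have h := ProbabilityTheory.uniformOn_apply_finset (s := (finite_children (o := o) hG v).toFinset)
    (t := {w})
  rw [Set.Finite.coe_toFinset, Finset.coe_singleton] at h
  rw [h, Finset.inter_singleton_of_mem (by simpa using hw),
    Set.ncard_eq_toFinset_card _ (finite_children hG v)]
  simp

theorem ae_isChildMap (hq : 2 ≤ q) (hG : IsHomogeneousTree G q) :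
    letI : MeasurableSpace V := ⊤
    ∀ᵐ c ∂(Measure.infinitePi (stepMeasure G o)), IsChildMap G o c := by
  have := countable_vertices o hG
  let _ : MeasurableSpace V := ⊤
  refine ae_all_iff.2 fun v => ?_
  have h := measurePreserving_eval_infinitePi (stepMeasure G o) v
  refine h.quasiMeasurePreserving.ae (p := fun w => w ∈ children G o v) ?_
  have hm : MeasurableSet (children G o v) := trivial
  exact (mem_ae_iff_prob_eq_one hm).2 (stepMeasure_children hq hG v)

theorem measurable_iterate (hG : IsHomogeneousTree G q) :
    letI : MeasurableSpace V := ⊤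
    Measurable (fun (c : V → V) (n : ℕ) => c^[n] o) := by
  have := countable_vertices o hG
  let _ : MeasurableSpace V := ⊤
  refine measurable_pi_iff.2 fun n => ?_
  induction n with
  | zero => exact measurable_const
  | succ n ih =>
    simp only [Function.iterate_succ_apply']
    refine measurable_to_countable' fun w => ?_
    have : (fun c : V → V => c (c^[n] o)) ⁻¹' {w} =
        ⋃ v, (fun c : V → V => c^[n] o) ⁻¹' {v} ∩ (fun c : V → V => c v) ⁻¹' {w} := by
      ext c
      simp
    rw [this]
    exact MeasurableSet.iUnion fun v => (ih (measurableSet_singleton v)).inter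
      ((measurable_pi_apply v) (measurableSet_singleton w))

/-- Almost every `c` is a child map, and its orbit of `o` is then a ray, so events about the ray can
be computed as events about `c`. -/
theorem boundaryMeasure_image (hq : 2 ≤ q) (hG : IsHomogeneousTree G q) {s : Set (Boundary G o)}
    {t : Set (V → V)} (hs : MeasurableSet s)
    (h : ∀ c (hc : IsChildMap G o c), hc.ray hG ∈ s ↔ c ∈ t) :
    letI : MeasurableSpace V := ⊤
    boundaryMeasure G o s = Measure.infinitePi (stepMeasure G o) t := by
  let _ : MeasurableSpace V := ⊤
  have he := measurableEmbedding_ray (o := o) hG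
  rw [boundaryMeasure, he.comap_apply,
    Measure.map_apply (measurable_iterate hG) (he.measurableSet_image.2 hs)]
  refine measure_congr ?_
  filter_upwards [ae_isChildMap hq hG] with c hc
  have h1 : hc.ray hG ∈ s ↔ c ∈ (fun (c : V → V) (n : ℕ) => c^[n] o) ⁻¹' (Boundary.ray '' s) :=
    (he.injective.mem_set_image (a := hc.ray hG)).symm
  exact propext (h1.symm.trans (h c hc))

theorem isProbabilityMeasure_boundaryMeasure (hq : 2 ≤ q) (hG : IsHomogeneousTree G q) :
    IsProbabilityMeasure (boundaryMeasure G o) := by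
  constructor
  let _ : MeasurableSpace V := ⊤
  rw [boundaryMeasure_image hq hG (t := Set.univ) MeasurableSet.univ (by simp)]
  exact measure_univ

/-- The orbit reaches `w` exactly when `c` chooses the right child at every earlier vertex of the
geodesic to `w`. These are distinct coordinates, so the probabilities multiply: `1 / (q + 1)` at the
root and `1 / q` at each other vertex. The distance bound on `S` ensures that the next coordinate is
new. -/
theorem exists_box (hq : 2 ≤ q) (hG : IsHomogeneousTree G q) (n : ℕ) :
    ∀ w : V, G.dist o w = n + 1 → ∃ (S : Finset V) (t : V → V), (∀ u ∈ S, G.dist o u < n + 1) ∧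
      (∀ c, IsChildMap G o c → (c^[n + 1] o = w ↔ ∀ u ∈ S, c u = t u)) ∧
      ∏ u ∈ S, stepMeasure G o u {t u} = ((q + 1 : ENNReal) * q ^ n)⁻¹ := by
  classical
  induction n with
  | zero =>
    intro w hw
    refine ⟨{o}, fun _ => w, by simp, by simp, ?_⟩
    have hmem : w ∈ children G o o :=
      ⟨SimpleGraph.dist_eq_one_iff_adj.1 (by simpa using hw), by simpa using hw⟩
    rw [Finset.prod_singleton, stepMeasure_singleton hq hG hmem, ncard_children_root hG]
    simp
  | succ n ih =>
    intro w hw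
    obtain ⟨v, hv, h⟩ := exists_parent (o := o) (x := w) hG.isTree (by rintro rfl; simp at hw)
    obtain ⟨S, t, hS, hc, hp⟩ := ih v (by omega)
    have hvS : v ∉ S := fun hvS => by have := hS v hvS; omega
    have hvo : v ≠ o := by rintro rfl; rw [G.dist_self] at h; omega
    refine ⟨insert v S, Function.update t v w, ?_, ?_, ?_⟩
    · intro u hu
      rcases Finset.mem_insert.1 hu with rfl | hu
      · omega
      · have := hS u hu; omega
    · intro c hcm
      have h1 : c^[n + 1 + 1] o = w ↔ c^[n + 1] o = v ∧ c v = w := by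
        rw [Function.iterate_succ_apply']
        constructor
        · intro hcw
          have hv' : c^[n + 1] o = v := by
            refine parent_unique (o := o) (x := w) hG.isTree ?_ ?_ hv h
            · exact hcw ▸ (hcm _).1
            · exact hcw ▸ (hcm _).2
          exact ⟨hv', hv' ▸ hcw⟩
        · rintro ⟨h1, h2⟩
          rw [h1, h2]
      rw [h1, hc c hcm, Finset.forall_mem_insert, Function.update_self, and_comm]
      refine and_congr_right fun _ => forall₂_congr fun u hu => ?_
      rw [Function.update_of_ne (by rintro rfl; exact hvS hu)]
    · rw [Finset.prod_insert hvS, Function.update_self, stepMeasure_singleton hq hG ⟨hv, h⟩,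
        ncard_children_of_ne hG hvo,
        Finset.prod_congr rfl (g := fun u => stepMeasure G o u {t u}), hp,
        ← ENNReal.mul_inv (Or.inr (by finiteness)) (Or.inl (by simp)), pow_succ]
      · ring_nf
      · intro u hu
        rw [Function.update_of_ne (by rintro rfl; exact hvS hu)]

theorem boundaryMeasure_shadow (hq : 2 ≤ q) (hG : IsHomogeneousTree G q) {w : V} {n : ℕ}
    (hw : G.dist o w = n + 1) :
    boundaryMeasure G o (shadow G o w) = ((q + 1 : ENNReal) * q ^ n)⁻¹ := by
  let _ : MeasurableSpace V := ⊤
  obtain ⟨S, t, -, hc, hp⟩ := exists_box hq hG n w hw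
  rw [boundaryMeasure_image hq hG (t := Set.pi (S : Set V) fun u => {t u})
    (measurableSet_shadow w), Measure.infinitePi_pi, hp]
  · exact fun _ _ => trivial
  · intro c hcm
    rw [mem_shadow hG.isTree, hw]
    exact (hc c hcm).trans (by simp [Set.mem_pi])

theorem boundaryMeasure_real_shadow (hq : 2 ≤ q) (hG : IsHomogeneousTree G q) {w : V} {n : ℕ}
    (hw : G.dist o w = n + 1) :
    (boundaryMeasure G o).real (shadow G o w) = ((q + 1 : ℝ) * q ^ n)⁻¹ := by
  rw [Measure.real, boundaryMeasure_shadow hq hG hw, ENNReal.toReal_inv, ENNReal.toReal_mul]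
  norm_cast

end BoundaryMeasure

/-! ### Spherical functions as boundary integrals -/

section Spherical

/-- Off `E(w)` the height drops by one from `v` to `w`; on `E(w)` both heights are explicit.
Integrated, this is the recursion for spherical functions; solved for the indicator, it expresses
`E(w)` through waves. -/
theorem zpow_height_child (hT : G.IsTree) {v w : V} (hv : G.Adj v w)
    (ho : G.dist o w = G.dist o v + 1) {a : ℂ} (ha : a ≠ 0) (ω : Boundary G o) :
    a ^ height ω w = a⁻¹ * a ^ height ω v +
      (shadow G o w).indicator (fun _ => a ^ G.dist o v * (a - a⁻¹)) ω := by
  by_cases h : ω ∈ shadow G o w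
  · rw [Set.indicator_of_mem h, height_self_of_mem hT h, height_parent_of_mem hT hv ho h, ho]
    simp only [zpow_natCast, pow_succ]
    ring
  · rw [Set.indicator_of_notMem h, height_child_of_notMem hT hv ho h, zpow_sub_one₀ ha]
    ring

theorem norm_zpow_height_le {a : ℂ} {C : ℝ} (hC : 1 ≤ C) (ha : ‖a‖ ≤ C) (ha' : ‖a⁻¹‖ ≤ C)
    (ω : Boundary G o) (x : V) : ‖a ^ height ω x‖ ≤ C ^ G.dist o x := by
  have h := abs_height_le ω x
  obtain ⟨n, hn | hn⟩ := Int.eq_nat_or_neg (height ω x)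
  · rw [hn, Nat.abs_cast] at h
    rw [hn, zpow_natCast, norm_pow]
    exact (pow_le_pow_left₀ (norm_nonneg _) ha n).trans (pow_le_pow_right₀ hC (by exact_mod_cast h))
  · rw [hn, abs_neg, Nat.abs_cast] at h
    rw [hn, zpow_neg, zpow_natCast, ← inv_pow, norm_pow]
    exact (pow_le_pow_left₀ (norm_nonneg _) ha' n).trans
      (pow_le_pow_right₀ hC (by exact_mod_cast h))

theorem measurable_zpow_height (hG : IsHomogeneousTree G q) (a : ℂ) (x : V) :
    Measurable fun ω : Boundary G o => a ^ height ω x :=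
  (measurable_of_countable fun n : ℤ => a ^ n).comp (measurable_height hG x)

theorem exists_norm_zpow_height_le (a : ℂ) (x : V) :
    ∃ C, ∀ ω : Boundary G o, ‖a ^ height ω x‖ ≤ C :=
  ⟨_, fun ω => norm_zpow_height_le (C := max 1 (max ‖a‖ ‖a⁻¹‖)) (le_max_left _ _)
    ((le_max_left _ _).trans (le_max_right _ _)) ((le_max_right _ _).trans (le_max_right _ _)) ω x⟩

theorem integrable_zpow_height (hq : 2 ≤ q) (hG : IsHomogeneousTree G q) (a b : ℂ) (x y : V) :
    Integrable (fun ω : Boundary G o => a ^ height ω x * b ^ height ω y)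
      (boundaryMeasure G o) := by
  have := isProbabilityMeasure_boundaryMeasure (o := o) hq hG
  obtain ⟨C, hC⟩ := exists_norm_zpow_height_le (o := o) (G := G) a x
  obtain ⟨D, hD⟩ := exists_norm_zpow_height_le (o := o) (G := G) b y
  refine Integrable.of_bound ((measurable_zpow_height hG a x).mul
    (measurable_zpow_height hG b y)).aestronglyMeasurable (C * D) (.of_forall fun ω => ?_)
  rw [norm_mul]
  exact mul_le_mul (hC ω) (hD ω) (norm_nonneg _) ((norm_nonneg _).trans (hC ω))

theorem integral_child (hq : 2 ≤ q) (hG : IsHomogeneousTree G q) {v x y : V} (hv : G.Adj v x)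
    (ho : G.dist o x = G.dist o v + 1) {a b c : ℂ} (ha : a ≠ 0)
    (hc : ∀ ω ∈ shadow G o x, b ^ height ω y = c) :
    ∫ ω, a ^ height ω x * b ^ height ω y ∂(boundaryMeasure G o) =
      a⁻¹ * ∫ ω, a ^ height ω v * b ^ height ω y ∂(boundaryMeasure G o) +
        ((q + 1 : ℂ) * q ^ G.dist o v)⁻¹ * (a ^ G.dist o v * (a - a⁻¹) * c) := by
  have := isProbabilityMeasure_boundaryMeasure (o := o) hq hG
  have h1 : ∀ ω : Boundary G o, a ^ height ω x * b ^ height ω y =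
      a⁻¹ * (a ^ height ω v * b ^ height ω y) +
        (shadow G o x).indicator (fun _ => a ^ G.dist o v * (a - a⁻¹) * c) ω := by
    intro ω
    rw [zpow_height_child hG.isTree hv ho ha]
    by_cases h : ω ∈ shadow G o x
    · rw [Set.indicator_of_mem h, Set.indicator_of_mem h, hc ω h]
      ring
    · rw [Set.indicator_of_notMem h, Set.indicator_of_notMem h]
      ring
  simp_rw [h1]
  rw [integral_add ((integrable_zpow_height hq hG a b v y).const_mul _)
      ((integrable_const _).indicator (measurableSet_shadow x)), integral_const_mul,
    integral_indicator_const _ (measurableSet_shadow x), boundaryMeasure_real_shadow hq hG ho,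
    Complex.real_smul]
  push_cast
  rfl

/-- As `a * b = q`, the integrand is `q ^ h_ω(x)`. The recursion along parents is `I ↦ q⁻¹ I + (1 -
q⁻¹)`, which fixes `1`. -/
theorem integral_diagonal (hq : 2 ≤ q) (hG : IsHomogeneousTree G q) {a b : ℂ} (hab : a * b = q)
    (x : V) : ∫ ω, a ^ height ω x * b ^ height ω x ∂(boundaryMeasure G o) = 1 := by
  have := isProbabilityMeasure_boundaryMeasure (o := o) hq hG
  have hq0 : (q : ℂ) ≠ 0 := by norm_cast; omega
  have hq1 : (q : ℂ) + 1 ≠ 0 := by norm_cast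
  -- The factor `1 ^ height ω x` brings the integrand into the shape of `integral_child` with `b =
  -- 1`.
  have h1 : ∀ (x : V) (ω : Boundary G o), a ^ height ω x * b ^ height ω x =
      (q : ℂ) ^ height ω x * 1 ^ height ω x := by
    intro x ω
    rw [← mul_zpow, hab, one_zpow, mul_one]
  simp_rw [h1]
  induction hn : G.dist o x generalizing x with
  | zero =>
    obtain rfl := hG.isTree.connected.dist_eq_zero_iff.1 hn
    simp [height_root hG.isTree]
  | succ n ih =>
    obtain ⟨v, hv, ho⟩ := exists_parent (o := o) (x := x) hG.isTree (by rintro rfl; simp at hn)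
    rw [integral_child hq hG hv ho hq0 (c := 1) (by simp)]
    have := ih v (by omega)
    simp only [one_zpow] at this ⊢
    rw [this]
    field_simp
    ring

/-- The spherical function: the integral depends only on the distance of the two vertices. -/
theorem sub_mul_integral (hq : 2 ≤ q) (hG : IsHomogeneousTree G q) {a b : ℂ} (hab : a * b = q)
    (x y : V) : (a - b) * ∫ ω, a ^ height ω x * b ^ height ω y ∂(boundaryMeasure G o) =
      q / (q + 1) * ((b ^ G.dist x y)⁻¹ * (a - a⁻¹) - (a ^ G.dist x y)⁻¹ * (b - b⁻¹)) := by
  have hq0 : (q : ℂ) ≠ 0 := by norm_cast; omega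
  have hq1 : (q : ℂ) + 1 ≠ 0 := by norm_cast
  -- Replacing the vertex farther from `o` by its parent lowers `d(x, y)` by one. Exchanging the
  -- vertices exchanges `a` and `b`, so these must be general. The factor `a - b` is kept because it
  -- vanishes at `s = 0` and `s = τ`.
  induction hn : G.dist o x + G.dist o y using Nat.strong_induction_on generalizing x y a b with
  | _ n ih =>
    have ha : a ≠ 0 := by rintro rfl; exact hq0 (by simpa using hab.symm)
    have hb : b ≠ 0 := by rintro rfl; exact hq0 (by simpa using hab.symm)
    by_cases hxy : x = y
    · subst hxy
      rw [integral_diagonal hq hG hab]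
      simp only [G.dist_self, pow_zero, inv_one, one_mul, mul_one]
      field_simp
      linear_combination (a - b) * hab
    · wlog hle : G.dist o y ≤ G.dist o x generalizing x y a b
      · have h := this (by rwa [mul_comm]) y x (by omega) hb ha (Ne.symm hxy) (by omega)
        simp_rw [G.dist_comm (u := y) (v := x), mul_comm (b ^ height _ y)] at h
        linear_combination -h
      · have hxo : x ≠ o := by
          rintro rfl
          rw [G.dist_self] at hle
          exact hxy (hG.isTree.connected.dist_eq_zero_iff.1 (by omega))
        obtain ⟨v, hv, ho⟩ := exists_parent hG.isTree hxo
        have hd := dist_parent_add_one hG.isTree hv ho hle (Ne.symm hxy)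
        rw [integral_child hq hG hv ho ha (c := b ^ ((G.dist o x : ℤ) - G.dist x y))
          (fun ω hω => by rw [height_of_mem_shadow hG.isTree hω hle]), mul_add, mul_left_comm,
          ih _ (by omega) hab v y rfl, ← hd, ho, zpow_sub₀ hb, ← hab, mul_pow]
        have hab1 : a * b + 1 ≠ 0 := by rwa [hab]
        simp only [zpow_natCast, pow_succ]
        field_simp
        ring

end Spherical

/-! ### Waves as powers of `q ^ (1/2 + i s)` -/

section Zeta

/-- `q ^ (1/2 + i s)`. -/
def zeta (q : ℕ) (s : ℝ) : ℂ := (q : ℂ) ^ (1 / 2 + Complex.I * (s : ℂ))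

theorem zeta_neg (s : ℝ) : zeta q (-s) = (q : ℂ) ^ (1 / 2 - Complex.I * (s : ℂ)) := by
  rw [zeta]
  push_cast
  ring_nf

theorem zeta_mul_zeta_neg (hq : 2 ≤ q) (s : ℝ) : zeta q s * zeta q (-s) = q := by
  have hq0 : (q : ℂ) ≠ 0 := by norm_cast; omega
  rw [zeta_neg, zeta, ← Complex.cpow_add _ _ hq0]
  ring_nf
  rw [Complex.cpow_one]

theorem zeta_eq (hq : 2 ≤ q) (s : ℝ) :
    zeta q s = (Real.sqrt q : ℂ) * Complex.exp (↑(s * Real.log q) * Complex.I) := by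
  have hq0 : (q : ℂ) ≠ 0 := by norm_cast; omega
  rw [zeta, Complex.cpow_add _ _ hq0, Complex.cpow_def_of_ne_zero hq0 (Complex.I * _),
    Real.sqrt_eq_rpow, Complex.ofReal_cpow (by positivity), ← Complex.natCast_log]
  push_cast
  ring_nf

theorem norm_zeta (hq : 2 ≤ q) (s : ℝ) : ‖zeta q s‖ = Real.sqrt q := by
  rw [zeta_eq hq, norm_mul, Complex.norm_exp_ofReal_mul_I, mul_one, Complex.norm_real,
    Real.norm_of_nonneg (Real.sqrt_nonneg _)]

theorem conj_zeta (hq : 2 ≤ q) (s : ℝ) : (starRingEnd ℂ) (zeta q s) = zeta q (-s) := by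
  rw [zeta_eq hq, zeta_eq hq, map_mul, Complex.conj_ofReal, ← Complex.exp_conj, map_mul,
    Complex.conj_ofReal, Complex.conj_I]
  push_cast
  ring_nf

theorem zeta_ne_zero (hq : 2 ≤ q) (s : ℝ) : zeta q s ≠ 0 := by
  rw [← norm_pos_iff, norm_zeta hq]
  have : (0 : ℝ) < q := by norm_cast; omega
  positivity

theorem continuous_zeta (hq : 2 ≤ q) : Continuous (zeta q) := by
  rw [funext (zeta_eq hq)]
  fun_prop

theorem wavePlus_eq (p : Phase G o q) (x : V) : wavePlus p x = zeta q p.2 ^ height p.1 x := by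
  rw [wavePlus, zeta, Complex.cpow_mul_int]

theorem waveMinus_eq (p : Phase G o q) (x : V) : waveMinus p x = zeta q (-p.2) ^ height p.1 x := by
  rw [waveMinus, zeta_neg, Complex.cpow_mul_int]

theorem conj_wavePlus (hq : 2 ≤ q) (p : Phase G o q) (x : V) :
    (starRingEnd ℂ) (wavePlus p x) = waveMinus p x := by
  rw [wavePlus_eq, waveMinus_eq, map_zpow₀, conj_zeta hq]

theorem one_lt_sqrt (hq : 2 ≤ q) : 1 < Real.sqrt q := by
  rw [Real.lt_sqrt] <;> norm_num
  omega

theorem norm_zpow_zeta_le (hq : 2 ≤ q) (s : ℝ) (ω : Boundary G o) (x : V) :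
    ‖zeta q s ^ height ω x‖ ≤ Real.sqrt q ^ G.dist o x := by
  have h1 := one_lt_sqrt hq
  refine norm_zpow_height_le h1.le (norm_zeta hq s).le ?_ ω x
  rw [norm_inv, norm_zeta hq]
  exact (inv_le_one_of_one_le₀ h1.le).trans h1.le

theorem norm_inv_zpow_zeta_le (hq : 2 ≤ q) (s : ℝ) (ω : Boundary G o) (x : V) :
    ‖(zeta q s ^ height ω x)⁻¹‖ ≤ Real.sqrt q ^ G.dist o x := by
  have h1 := one_lt_sqrt hq
  rw [← inv_zpow]
  refine norm_zpow_height_le h1.le ?_ ?_ ω x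
  · rw [norm_inv, norm_zeta hq]
    exact (inv_le_one_of_one_le₀ h1.le).trans h1.le
  · rw [inv_inv, norm_zeta hq]

theorem measurable_wavePlus (hG : IsHomogeneousTree G q) (x : V) :
    Measurable fun p : Phase G o q => wavePlus p x := by
  have h : Measurable fun p : Phase G o q => (height p.1 x : ℂ) :=
    (measurable_of_countable fun n : ℤ => (n : ℂ)).comp
      ((measurable_height hG x).comp measurable_fst)
  unfold wavePlus
  fun_prop

theorem measurable_waveMinus (hG : IsHomogeneousTree G q) (x : V) :
    Measurable fun p : Phase G o q => waveMinus p x := by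
  have h : Measurable fun p : Phase G o q => (height p.1 x : ℂ) :=
    (measurable_of_countable fun n : ℤ => (n : ℂ)).comp
      ((measurable_height hG x).comp measurable_fst)
  unfold waveMinus
  fun_prop

end Zeta

/-! ### The Plancherel density -/

section Plancherel

theorem sub_inv_ne_zero {r : ℝ} (hr : 1 < r) {a : ℂ} (ha : ‖a‖ = r) : a - a⁻¹ ≠ 0 := by
  intro h
  have h1 := congrArg norm (sub_eq_zero.1 h)
  rw [norm_inv, ha] at h1
  have h2 := inv_lt_one_of_one_lt₀ hr
  linarith

/-- The density of the Plancherel measure. -/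
def density (q : ℕ) (s : ℝ) : ℝ := cP q * (‖cFun q (s : ℂ)‖ ^ 2)⁻¹

theorem density_nonneg (q : ℕ) (s : ℝ) : 0 ≤ density q s := by
  have : 0 ≤ Real.log q := Real.log_natCast_nonneg q
  unfold density cP
  have := Real.pi_pos
  positivity

/-- In terms of `zeta` the denominator never vanishes, since `|zeta q s| = √q > 1`, so continuity is
visible. At zeros of the denominator of `cFun`, such as `s = 0` and `s = τ`, the convention `x / 0 =
0` makes both sides zero. -/
theorem density_eq (hq : 2 ≤ q) (s : ℝ) :
    density q s = cP q * ((q + 1) ^ 2 / q ^ 2 *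
      (‖zeta q s - zeta q (-s)‖ ^ 2 / ‖zeta q s - (zeta q s)⁻¹‖ ^ 2)) := by
  have hq0 : (q : ℂ) ≠ 0 := by norm_cast; omega
  have hqr : (0 : ℝ) < q := by norm_cast; omega
  set r : ℂ := (q : ℂ) ^ (1 / 2 : ℂ) with hr
  have hr0 : r ≠ 0 := by simp [hr, Complex.cpow_eq_zero_iff, hq0]
  have h1 : (q : ℂ) ^ (Complex.I * (s : ℂ)) = r⁻¹ * zeta q s := by
    rw [zeta, Complex.cpow_add _ _ hq0, ← hr]
    field_simp
  have h2 : (q : ℂ) ^ (-(Complex.I * (s : ℂ))) = r⁻¹ * zeta q (-s) := by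
    rw [zeta_neg, sub_eq_add_neg, Complex.cpow_add _ _ hq0, ← hr]
    field_simp
  have h3 : (q : ℂ) ^ (-(1 / 2) - Complex.I * (s : ℂ)) = (zeta q s)⁻¹ := by
    rw [zeta, ← Complex.cpow_neg]
    ring_nf
  have hrn : ‖r‖ ^ 2 = q := by
    have : r ^ 2 = q := by
      rw [hr, ← Complex.cpow_nat_mul]
      norm_num
    rw [← norm_pow, this, Complex.norm_natCast]
  have hc : cFun q (s : ℂ) = r ^ 2 / ((q : ℂ) + 1) *
      ((zeta q s - (zeta q s)⁻¹) / (zeta q s - zeta q (-s))) := by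
    rw [cFun, h1, h2, h3, ← mul_sub, ← hr]
    change r / _ * ((zeta q s - _) / _) = _
    simp only [div_eq_mul_inv, mul_inv, inv_inv]
    ring
  have hq1 : ‖(q : ℂ) + 1‖ = q + 1 := by exact_mod_cast Complex.norm_natCast (q + 1)
  rw [density, hc, norm_mul, norm_div, norm_div, norm_pow, hrn, hq1]
  congr 1
  simp only [div_eq_mul_inv, mul_inv, inv_inv, mul_pow, inv_pow]
  ring

theorem continuous_density (hq : 2 ≤ q) : Continuous (density q) := by
  rw [funext (density_eq hq)]
  have h := continuous_zeta hq
  refine continuous_const.mul (continuous_const.mul (Continuous.div ?_ ?_ ?_))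
  · exact ((h.sub (h.comp continuous_neg)).norm.pow 2)
  · exact (h.sub (h.inv₀ (zeta_ne_zero hq))).norm.pow 2
  · intro s
    exact pow_ne_zero _ (norm_ne_zero_iff.2 (sub_inv_ne_zero (one_lt_sqrt hq) (norm_zeta hq s)))

instance isFiniteMeasure_comap_val (q : ℕ) :
    IsFiniteMeasure ((volume : Measure ℝ).comap (Subtype.val : Set.Icc (0 : ℝ) (tau q) → ℝ)) := by
  constructor
  rw [comap_subtype_coe_apply measurableSet_Icc, Set.image_univ, Subtype.range_val,
    Real.volume_Icc]
  exact ENNReal.ofReal_lt_top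

theorem isFiniteMeasure_plancherel (hq : 2 ≤ q) : IsFiniteMeasure (plancherel q) := by
  refine isFiniteMeasure_withDensity_ofReal (f := fun s : Set.Icc (0 : ℝ) (tau q) => density q s) ?_
  exact ((continuous_density hq).comp continuous_subtype_val).integrable_of_hasCompactSupport
    (HasCompactSupport.of_compactSpace _) |>.2

theorem integral_plancherel (hq : 2 ≤ q) (f : ℝ → ℂ) :
    ∫ s, f s ∂(plancherel q) = ∫ s in (0 : ℝ)..tau q, (density q s : ℂ) * f s := by
  have htau : 0 ≤ tau q := div_nonneg Real.pi_pos.le (Real.log_natCast_nonneg q)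
  have h := integral_withDensity_eq_integral_toReal_smul
    (μ := (volume : Measure ℝ).comap (Subtype.val : Set.Icc (0 : ℝ) (tau q) → ℝ))
    (f := fun s => ENNReal.ofReal (density q s))
    ((continuous_density hq).comp continuous_subtype_val).measurable.ennreal_ofReal
    (.of_forall fun s => ENNReal.ofReal_lt_top) (fun s => f s)
  rw [plancherel]
  refine h.trans ?_
  simp only [ENNReal.toReal_ofReal (density_nonneg q _), Complex.real_smul]
  rw [intervalIntegral.integral_of_le htau, ← integral_Icc_eq_integral_Ioc]
  exact integral_subtype_comap measurableSet_Icc (fun s => (density q s : ℂ) * f s)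

end Plancherel

/-! ### Orthonormality of the waves -/

section Orthonormality

/-- The holomorphic function whose real part on the circle `|u| = √q` is, up to a constant, the
spherical function times the Plancherel density. -/
def sphericalHol (q d : ℕ) (u : ℂ) : ℂ := q * (u / q) ^ d * (q - u ^ 2) / (q ^ 2 - u ^ 2)

theorem sphericalHol_eq {a b : ℂ} (hq0 : (q : ℂ) ≠ 0) (hab : a * b = q) (hb : b - b⁻¹ ≠ 0)
    (d : ℕ) : sphericalHol q d a = (b ^ d)⁻¹ * (b - a) / (b - b⁻¹) := by
  have ha : a ≠ 0 := by rintro rfl; exact hq0 (by simpa using hab.symm)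
  have hb0 : b ≠ 0 := by rintro rfl; exact hq0 (by simpa using hab.symm)
  have h1 : b ^ 2 - 1 ≠ 0 := by
    intro h
    apply hb
    field_simp
    rw [h, mul_zero]
  have h2 : (a * b) ^ 2 - a ^ 2 ≠ 0 := by
    have : (a * b) ^ 2 - a ^ 2 = a ^ 2 * (b ^ 2 - 1) := by ring
    rw [this]
    positivity
  have h3 : a / (a * b) = b⁻¹ := by field_simp
  rw [sphericalHol, ← hab, h3, inv_pow, div_eq_div_iff h2 hb]
  field_simp

/-- With `a`, `b` the two conjugate zetas, `A = a - a⁻¹` and `B = b - b⁻¹`, the density contributes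
`(a - b) * (b - a) / (A * B)`. The factor `a - b` is absorbed by `sub_mul_integral`, and dividing
its two terms by `A * B` leaves one summand with denominator `B` and one with `A`. -/
theorem density_mul_integral (hq : 2 ≤ q) (hG : IsHomogeneousTree G q) (x y : V) (s : ℝ) :
    (density q s : ℂ) *
        ∫ ω, zeta q s ^ height ω x * zeta q (-s) ^ height ω y ∂(boundaryMeasure G o) =
      cP q * ((q + 1) / q) *
        (sphericalHol q (G.dist x y) (zeta q s) + sphericalHol q (G.dist x y) (zeta q (-s))) := by
  have hq0 : (q : ℂ) ≠ 0 := by norm_cast; omega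
  have hq1 : (q : ℂ) + 1 ≠ 0 := by norm_cast
  have hab := zeta_mul_zeta_neg hq s
  have hJ := sub_mul_integral (o := o) hq hG hab x y
  have ha := sub_inv_ne_zero (one_lt_sqrt hq) (norm_zeta hq s)
  have hb := sub_inv_ne_zero (one_lt_sqrt hq) (norm_zeta hq (-s))
  have hn1 : ((‖zeta q s - zeta q (-s)‖ ^ 2 : ℝ) : ℂ) =
      (zeta q s - zeta q (-s)) * (zeta q (-s) - zeta q s) := by
    rw [Complex.ofReal_pow, ← Complex.mul_conj', map_sub, conj_zeta hq, conj_zeta hq, neg_neg]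
  have hn2 : ((‖zeta q s - (zeta q s)⁻¹‖ ^ 2 : ℝ) : ℂ) =
      (zeta q s - (zeta q s)⁻¹) * (zeta q (-s) - (zeta q (-s))⁻¹) := by
    rw [Complex.ofReal_pow, ← Complex.mul_conj', map_sub, map_inv₀, conj_zeta hq]
  rw [density_eq hq, sphericalHol_eq hq0 hab hb, sphericalHol_eq hq0 ((mul_comm _ _).trans hab) ha,
    Complex.ofReal_mul, Complex.ofReal_mul, Complex.ofReal_div (‖_‖ ^ 2), hn1, hn2]
  push_cast
  generalize zeta q s - (zeta q s)⁻¹ = A at *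
  generalize zeta q (-s) - (zeta q (-s))⁻¹ = B at *
  generalize (zeta q s ^ G.dist x y)⁻¹ = A' at *
  generalize (zeta q (-s) ^ G.dist x y)⁻¹ = B' at *
  generalize ∫ ω, zeta q s ^ height ω x * zeta q (-s) ^ height ω y ∂(boundaryMeasure G o) = J at *
  generalize zeta q s = a at *
  generalize zeta q (-s) = b at *
  field_simp at hJ ⊢
  linear_combination (b - a) * cP q * hJ

/-- The poles `±q` lie outside the closed disc of radius `√q`. -/
theorem diffContOnCl_sphericalHol (hq : 2 ≤ q) (d : ℕ) :
    DiffContOnCl ℂ (sphericalHol q d) (Metric.ball 0 |Real.sqrt q|) := by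
  have hqr : (1 : ℝ) < q := by norm_cast
  refine DifferentiableOn.diffContOnCl_ball (U := Metric.closedBall 0 |Real.sqrt q|) ?_ subset_rfl
  intro u hu
  refine DifferentiableAt.differentiableWithinAt ?_
  unfold sphericalHol
  refine DifferentiableAt.div (by fun_prop) (by fun_prop) ?_
  intro h
  have h1 := congrArg norm (sub_eq_zero.1 h)
  rw [norm_pow, norm_pow, Complex.norm_natCast] at h1
  rw [mem_closedBall_zero_iff, abs_of_nonneg (Real.sqrt_nonneg _)] at hu
  have h2 := pow_le_pow_left₀ (norm_nonneg _) hu 2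
  rw [Real.sq_sqrt (by positivity)] at h2
  nlinarith

/-- As `s` runs through `[-τ, τ]`, `zeta q s` runs once around the circle `|u| = √q`, so this is the
mean value property. -/
theorem integral_sphericalHol (hq : 2 ≤ q) (d : ℕ) :
    ∫ s in (-tau q)..tau q, sphericalHol q d (zeta q s) =
      2 * tau q * sphericalHol q d 0 := by
  have hlog : 0 < Real.log q := Real.log_pos (by norm_cast)
  have h1 : ∀ s, sphericalHol q d (zeta q s) =
      (fun θ => sphericalHol q d (circleMap 0 (Real.sqrt q) θ)) (s * Real.log q) := by
    intro s
    rw [zeta_eq hq]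
    simp [circleMap]
  have hper : Function.Periodic (fun θ => sphericalHol q d (circleMap 0 (Real.sqrt q) θ))
      (2 * Real.pi) := (periodic_circleMap 0 (Real.sqrt q)).comp (sphericalHol q d)
  have h2 := (diffContOnCl_sphericalHol hq d).circleAverage
  rw [Real.circleAverage_def] at h2
  have h3 := hper.intervalIntegral_add_eq (-Real.pi) 0
  rw [zero_add, show -Real.pi + 2 * Real.pi = Real.pi by ring] at h3
  rw [intervalIntegral.integral_congr fun s _ => h1 s,
    intervalIntegral.integral_comp_mul_right
      (fun θ => sphericalHol q d (circleMap 0 (Real.sqrt q) θ)) hlog.ne', tau, neg_mul,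
    div_mul_cancel₀ _ hlog.ne', h3, ← h2, Complex.real_smul, Complex.real_smul]
  have := Real.pi_pos.ne'
  push_cast
  have hl' : Complex.log q ≠ 0 := by
    rw [← Complex.natCast_log]; exact_mod_cast hlog.ne'
  field_simp

/-- The reflection `s ↦ -s` joins the two summands into an integral over the full circle. The value
at the centre is `0 ^ d(x, y)`, and `cP` normalizes the constant to one. -/
theorem integral_density_mul (hq : 2 ≤ q) (hG : IsHomogeneousTree G q) (x y : V) :
    ∫ s in (0 : ℝ)..tau q, (density q s : ℂ) *
        ∫ ω, zeta q s ^ height ω x * zeta q (-s) ^ height ω y ∂(boundaryMeasure G o) =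
      if G.dist x y = 0 then 1 else 0 := by
  have hq0 : (q : ℂ) ≠ 0 := by norm_cast; omega
  have hlog : 0 < Real.log q := Real.log_pos (by norm_cast)
  have hc : Continuous fun s => sphericalHol q (G.dist x y) (zeta q s) := by
    have h := (diffContOnCl_sphericalHol hq (G.dist x y)).continuousOn
    refine h.comp_continuous (continuous_zeta hq) fun s => ?_
    have : 0 < Real.sqrt q := zero_lt_one.trans (one_lt_sqrt hq)
    rw [closure_ball _ (abs_pos.2 this.ne').ne', mem_closedBall_zero_iff, norm_zeta hq]
    exact le_abs_self _
  have hc' : Continuous fun s => sphericalHol q (G.dist x y) (zeta q (-s)) :=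
    hc.comp continuous_neg
  simp_rw [density_mul_integral hq hG]
  rw [intervalIntegral.integral_const_mul, intervalIntegral.integral_add (hc.intervalIntegrable _ _)
      (hc'.intervalIntegrable _ _), add_comm (intervalIntegral _ _ _ _),
    intervalIntegral.integral_comp_neg (fun s => sphericalHol q (G.dist x y) (zeta q s)), neg_zero,
    intervalIntegral.integral_add_adjacent_intervals (hc.intervalIntegrable _ _)
      (hc.intervalIntegrable _ _), integral_sphericalHol hq]
  split_ifs with h
  · have hl' : Complex.log q ≠ 0 := by
      rw [← Complex.natCast_log]; exact_mod_cast hlog.ne'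
    have hpi : (Real.pi : ℂ) ≠ 0 := by exact_mod_cast Real.pi_pos.ne'
    have hq1 : (q : ℂ) + 1 ≠ 0 := by norm_cast
    rw [h, sphericalHol, cP, tau]
    push_cast
    rw [zero_div, pow_zero, zero_pow two_ne_zero, sub_zero, sub_zero, mul_one]
    field_simp
  · simp [sphericalHol, h]

theorem isFiniteMeasure_phaseMeasure (hq : 2 ≤ q) (hG : IsHomogeneousTree G q) :
    IsFiniteMeasure (phaseMeasure G o q) := by
  have := isProbabilityMeasure_boundaryMeasure (o := o) hq hG
  have := isFiniteMeasure_plancherel hq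
  unfold phaseMeasure
  infer_instance

theorem norm_wavePlus_le (hq : 2 ≤ q) (p : Phase G o q) (x : V) :
    ‖wavePlus p x‖ ≤ Real.sqrt q ^ G.dist o x :=
  wavePlus_eq p x ▸ norm_zpow_zeta_le hq _ _ _

theorem norm_waveMinus_le (hq : 2 ≤ q) (p : Phase G o q) (x : V) :
    ‖waveMinus p x‖ ≤ Real.sqrt q ^ G.dist o x :=
  waveMinus_eq p x ▸ norm_zpow_zeta_le hq _ _ _

theorem norm_inv_waveMinus_le (hq : 2 ≤ q) (p : Phase G o q) (x : V) :
    ‖(waveMinus p x)⁻¹‖ ≤ Real.sqrt q ^ G.dist o x :=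
  waveMinus_eq p x ▸ norm_inv_zpow_zeta_le hq _ _ _

theorem waveMinus_ne_zero (hq : 2 ≤ q) (p : Phase G o q) (x : V) : waveMinus p x ≠ 0 :=
  waveMinus_eq p x ▸ zpow_ne_zero _ (zeta_ne_zero hq _)

theorem memLp_waveMinus (hq : 2 ≤ q) (hG : IsHomogeneousTree G q) (x : V) (r : ENNReal) :
    MemLp (fun p => waveMinus p x) r (phaseMeasure G o q) := by
  have := isFiniteMeasure_phaseMeasure (o := o) hq hG
  exact MemLp.of_bound (measurable_waveMinus hG x).aestronglyMeasurable _
    (.of_forall fun p => norm_waveMinus_le hq p x)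

theorem integrable_mul_wavePlus (hq : 2 ≤ q) (hG : IsHomogeneousTree G q) {g : Phase G o q → ℂ}
    (hg : Integrable g (phaseMeasure G o q)) (x : V) :
    Integrable (fun p => g p * wavePlus p x) (phaseMeasure G o q) :=
  hg.mul_bdd (measurable_wavePlus hG x).aestronglyMeasurable
    (.of_forall fun p => norm_wavePlus_le hq p x)

/-- The functions `q ^ ((1/2 + i s) h_ω(x))` are orthonormal. -/
theorem integral_waveMinus_mul_wavePlus (hq : 2 ≤ q) (hG : IsHomogeneousTree G q) (x y : V) :
    ∫ p, waveMinus p y * wavePlus p x ∂(phaseMeasure G o q) =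
      if G.dist x y = 0 then 1 else 0 := by
  have := isProbabilityMeasure_boundaryMeasure (o := o) hq hG
  have := isFiniteMeasure_plancherel hq
  have := isFiniteMeasure_phaseMeasure (o := o) hq hG
  have hint := integrable_mul_wavePlus (o := o) hq hG
    ((memLp_waveMinus hq hG y 1).integrable le_rfl) x
  rw [phaseMeasure] at hint ⊢
  rw [integral_prod_symm _ hint, ← integral_density_mul (o := o) hq hG x y,
    ← integral_plancherel hq fun s => ∫ ω, zeta q s ^ height ω x * zeta q (-s) ^ height ω y
      ∂(boundaryMeasure G o)]
  simp_rw [wavePlus_eq, waveMinus_eq, mul_comm]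

end Orthonormality

/-! ### Integrable functions that annihilate all waves vanish -/

section Totality

/-- `g` is integrable and annihilates all functions `q ^ ((1/2 + i s) h_ω(y))`. -/
def Annihilates (g : Phase G o q → ℂ) : Prop :=
  Integrable g (phaseMeasure G o q) ∧
    ∀ y, ∫ p, g p * wavePlus p y ∂(phaseMeasure G o q) = 0

/-- The eigenvalue `q ^ (1/2 + i s) + q ^ (1/2 - i s)` of the adjacency operator. -/
def eigenvalue (q : ℕ) : C(Set.Icc (0 : ℝ) (tau q), ℝ) where
  toFun s := 2 * Real.sqrt q * Real.cos (s * Real.log q)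

theorem eigenvalue_eq (hq : 2 ≤ q) (s : Set.Icc (0 : ℝ) (tau q)) :
    (eigenvalue q s : ℂ) = zeta q s + zeta q (-s) := by
  rw [zeta_eq hq, zeta_eq hq]
  simp only [eigenvalue, ContinuousMap.coe_mk]
  push_cast
  rw [mul_right_comm, Complex.two_cos]
  ring_nf

/-- The length `τ` makes `s log q` range over `[0, π]`, where the cosine is injective. -/
theorem eigenvalue_injective (hq : 2 ≤ q) : Function.Injective (eigenvalue q) := by
  intro s t h
  have hlog : 0 < Real.log q := Real.log_pos (by norm_cast)
  have h0 := zero_lt_one.trans (one_lt_sqrt hq)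
  have hmem : ∀ r : Set.Icc (0 : ℝ) (tau q), (r : ℝ) * Real.log q ∈ Set.Icc 0 Real.pi := fun r =>
    ⟨mul_nonneg r.2.1 hlog.le, (le_div_iff₀ hlog).1 r.2.2⟩
  have h1 : Real.cos (s * Real.log q) = Real.cos (t * Real.log q) :=
    mul_left_cancel₀ (by positivity : 2 * Real.sqrt q ≠ 0) h
  exact Subtype.ext (mul_right_cancel₀ hlog.ne' (Real.injOn_cos (hmem s) (hmem t) h1))

/-- One neighbour lies above and contributes a factor `zeta q s`; the `q` others lie below and
contribute `q * (zeta q s)⁻¹ = zeta q (-s)`. -/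
theorem sum_neighbors_wavePlus (hq : 2 ≤ q) (hG : IsHomogeneousTree G q) (p : Phase G o q) (v : V) :
    ∑ u ∈ (hG.finite_neighborSet v).toFinset, wavePlus p u =
      (eigenvalue q p.2 : ℂ) * wavePlus p v := by
  classical
  obtain ⟨u, hu, h, h'⟩ := exists_height_neighbor hG.isTree p.1 v
  have hz := zeta_ne_zero hq p.2
  have hmem : u ∈ (hG.finite_neighborSet v).toFinset := by simpa using hu
  rw [← Finset.add_sum_erase _ _ hmem,
    Finset.sum_congr rfl (g := fun _ => (zeta q p.2) ^ (height p.1 v - 1)),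
    Finset.sum_const, Finset.card_erase_of_mem hmem,
    ← Set.ncard_eq_toFinset_card _ (hG.finite_neighborSet v), hG.ncard_neighborSet,
    eigenvalue_eq hq, wavePlus_eq, wavePlus_eq, h, zpow_add_one₀ hz, zpow_sub_one₀ hz,
    nsmul_eq_mul, Nat.add_sub_cancel, ← zeta_mul_zeta_neg hq p.2]
  · field_simp
  · intro u' hu'
    rw [Finset.mem_erase, Set.Finite.mem_toFinset] at hu'
    rw [wavePlus_eq, h' u' hu'.2 hu'.1]

theorem integrable_continuous_mul {g : Phase G o q → ℂ}
    (hg : Integrable g (phaseMeasure G o q)) (F : C(Set.Icc (0 : ℝ) (tau q), ℂ)) :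
    Integrable (fun p => F p.2 * g p) (phaseMeasure G o q) :=
  hg.bdd_mul (F.continuous.measurable.comp measurable_snd).aestronglyMeasurable
    (.of_forall fun p => F.norm_coe_le_norm p.2)

/-- The real functions of the spectral parameter that preserve the annihilator form an algebra. -/
def multipliers (hq : 2 ≤ q) (hG : IsHomogeneousTree G q) (o : V) :
    Subalgebra ℝ C(Set.Icc (0 : ℝ) (tau q), ℝ) where
  carrier := {F | ∀ g : Phase G o q → ℂ, Annihilates g → Annihilates fun p => (F p.2 : ℂ) * g p}
  mul_mem' {F F'} hF hF' g hg := by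
    have := hF _ (hF' g hg)
    simpa [mul_assoc] using this
  add_mem' {F F'} hF hF' g hg := by
    have h := hF g hg
    have h' := hF' g hg
    have he : (fun p : Phase G o q => (((F + F') p.2 : ℝ) : ℂ) * g p) =
        fun p => (F p.2 : ℂ) * g p + F' p.2 * g p := by
      ext p
      simp [add_mul]
    rw [he]
    refine ⟨h.1.add h'.1, fun y => ?_⟩
    simp_rw [add_mul (_ * g _)]
    rw [integral_add (integrable_mul_wavePlus hq hG h.1 y) (integrable_mul_wavePlus hq hG h'.1 y),
      h.2, h'.2, add_zero]
  algebraMap_mem' r g hg := by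
    refine ⟨by simpa using hg.1.const_mul (r : ℂ), fun y => ?_⟩
    simp [mul_assoc, integral_const_mul, hg.2 y]

theorem eigenvalue_mem_multipliers (hq : 2 ≤ q) (hG : IsHomogeneousTree G q) :
    eigenvalue q ∈ multipliers hq hG o := by
  intro g hg
  refine ⟨integrable_continuous_mul hg.1 ⟨fun s => (eigenvalue q s : ℂ), by fun_prop⟩,
    fun y => ?_⟩
  have h : ∀ p : Phase G o q, (eigenvalue q p.2 : ℂ) * g p * wavePlus p y =
      ∑ u ∈ (hG.finite_neighborSet y).toFinset, g p * wavePlus p u := by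
    intro p
    rw [← Finset.mul_sum, sum_neighbors_wavePlus hq hG]
    ring
  simp_rw [h]
  rw [integral_finsetSum _ fun u _ => integrable_mul_wavePlus hq hG hg.1 u]
  exact Finset.sum_eq_zero fun u _ => hg.2 u

/-- The multiplier algebra contains `eigenvalue q`, so it separates points and is dense by
Stone–Weierstrass. The integral is continuous in `F` by dominated convergence. -/
theorem Annihilates.integral_ofReal_mul (hq : 2 ≤ q) (hG : IsHomogeneousTree G q)
    {g : Phase G o q → ℂ} (hg : Annihilates g) (F : C(Set.Icc (0 : ℝ) (tau q), ℝ)) (y : V) :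
    ∫ p, (F p.2 : ℂ) * (g p * wavePlus p y) ∂(phaseMeasure G o q) = 0 := by
  have hgi := integrable_mul_wavePlus hq hG hg.1 y
  have hcont : Continuous fun F : C(Set.Icc (0 : ℝ) (tau q), ℝ) =>
      ∫ p, (F p.2 : ℂ) * (g p * wavePlus p y) ∂(phaseMeasure G o q) := by
    refine continuous_iff_continuousAt.2 fun F₀ => continuousAt_of_dominated
      (bound := fun p => (‖F₀‖ + 1) * ‖g p * wavePlus p y‖) (.of_forall fun F => ?_) ?_
      (hgi.norm.const_mul _) (.of_forall fun p => ?_)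
    · exact (integrable_continuous_mul hgi ⟨fun s => (F s : ℂ), by fun_prop⟩).aestronglyMeasurable
    · have hF : ∀ᶠ F in nhds F₀, ‖F‖ < ‖F₀‖ + 1 :=
        continuous_norm.continuousAt.eventually_lt continuousAt_const (by simp)
      filter_upwards [hF] with F hF
      refine .of_forall fun p => ?_
      rw [norm_mul, Complex.norm_real]
      exact mul_le_mul_of_nonneg_right ((F.norm_coe_le_norm p.2).trans hF.le) (norm_nonneg _)
    · exact ((Complex.continuous_ofReal.comp (continuous_eval_const p.2)).mul
        continuous_const).continuousAt
  have htop := ContinuousMap.subalgebra_topologicalClosure_eq_top_of_separatesPoints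
    (multipliers hq hG o) (fun s t hst =>
      ⟨eigenvalue q, ⟨eigenvalue q, eigenvalue_mem_multipliers hq hG, rfl⟩,
        fun h => hst (eigenvalue_injective hq h)⟩)
  have hF : F ∈ closure (multipliers hq hG o : Set C(Set.Icc (0 : ℝ) (tau q), ℝ)) := by
    rw [← Subalgebra.topologicalClosure_coe, htop]
    trivial
  refine closure_minimal (t := {F | ∫ p, (F p.2 : ℂ) * (g p * wavePlus p y)
    ∂(phaseMeasure G o q) = 0}) (fun F hF => ?_) (isClosed_eq hcont continuous_const) hF
  have := (hF g hg).2 y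
  simpa only [Set.mem_ofPred_eq, mul_assoc] using this

theorem Annihilates.integral_mul (hq : 2 ≤ q) (hG : IsHomogeneousTree G q)
    {g : Phase G o q → ℂ} (hg : Annihilates g) (F : C(Set.Icc (0 : ℝ) (tau q), ℂ)) (y : V) :
    ∫ p, F p.2 * (g p * wavePlus p y) ∂(phaseMeasure G o q) = 0 := by
  have hgi := integrable_mul_wavePlus hq hG hg.1 y
  let R : C(Set.Icc (0 : ℝ) (tau q), ℝ) := ⟨fun s => (F s).re, by fun_prop⟩
  let J : C(Set.Icc (0 : ℝ) (tau q), ℝ) := ⟨fun s => (F s).im, by fun_prop⟩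
  have h : ∀ p : Phase G o q, F p.2 * (g p * wavePlus p y) =
      (R p.2 : ℂ) * (g p * wavePlus p y) + Complex.I * ((J p.2 : ℂ) * (g p * wavePlus p y)) := by
    intro p
    have : F p.2 = R p.2 + J p.2 * Complex.I := (Complex.re_add_im _).symm
    rw [this]
    ring
  have hR : Integrable (fun p => (R p.2 : ℂ) * (g p * wavePlus p y)) (phaseMeasure G o q) :=
    integrable_continuous_mul hgi ⟨fun s => (R s : ℂ), by fun_prop⟩
  have hJ : Integrable (fun p => (J p.2 : ℂ) * (g p * wavePlus p y)) (phaseMeasure G o q) :=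
    integrable_continuous_mul hgi ⟨fun s => (J s : ℂ), by fun_prop⟩
  simp_rw [h]
  rw [integral_add hR (hJ.const_mul _), integral_const_mul, hg.integral_ofReal_mul hq hG,
    hg.integral_ofReal_mul hq hG]
  simp

/-- Solving `zpow_height_child` for the indicator writes it as a combination of the waves at `x` and
its parent, with coefficients continuous in `s`: the divisor is nonzero because `|zeta q s| > 1`. -/
theorem Annihilates.integral_indicator (hq : 2 ≤ q) (hG : IsHomogeneousTree G q)
    {g : Phase G o q → ℂ} (hg : Annihilates g) (F : C(Set.Icc (0 : ℝ) (tau q), ℂ)) (x : V) :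
    ∫ p, (Prod.fst ⁻¹' shadow G o x).indicator (fun p => F p.2 * g p) p
      ∂(phaseMeasure G o q) = 0 := by
  by_cases hx : x = o
  · subst hx
    have := hg.integral_mul hq hG F x
    simpa [shadow_root hG.isTree, wavePlus_eq, height_root hG.isTree] using this
  · obtain ⟨v, hv, ho⟩ := exists_parent hG.isTree hx
    have hz : Continuous fun s : Set.Icc (0 : ℝ) (tau q) => zeta q s :=
      (continuous_zeta hq).comp continuous_subtype_val
    have hzi : Continuous fun s : Set.Icc (0 : ℝ) (tau q) => (zeta q s)⁻¹ :=
      hz.inv₀ fun s => zeta_ne_zero hq s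
    have hne : ∀ s : ℝ, zeta q s ^ G.dist o v * (zeta q s - (zeta q s)⁻¹) ≠ 0 := fun s =>
      mul_ne_zero (pow_ne_zero _ (zeta_ne_zero hq s))
        (sub_inv_ne_zero (one_lt_sqrt hq) (norm_zeta hq s))
    let F₁ : C(Set.Icc (0 : ℝ) (tau q), ℂ) :=
      ⟨fun s => F s * (zeta q s ^ G.dist o v * (zeta q s - (zeta q s)⁻¹))⁻¹,
        F.continuous.mul (((hz.pow _).mul (hz.sub hzi)).inv₀ fun s => hne s)⟩
    let F₂ : C(Set.Icc (0 : ℝ) (tau q), ℂ) := ⟨fun s => F₁ s * (zeta q s)⁻¹, by fun_prop⟩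
    have h : ∀ p : Phase G o q, (Prod.fst ⁻¹' shadow G o x).indicator (fun p => F p.2 * g p) p =
        F₁ p.2 * (g p * wavePlus p x) - F₂ p.2 * (g p * wavePlus p v) := by
      intro p
      have h1 := zpow_height_child hG.isTree hv ho (zeta_ne_zero hq p.2) p.1
      rw [wavePlus_eq, wavePlus_eq, h1]
      simp only [F₂, F₁, ContinuousMap.coe_mk]
      by_cases hp : p.1 ∈ shadow G o x
      · rw [Set.indicator_of_mem (show p ∈ Prod.fst ⁻¹' shadow G o x from hp),
          Set.indicator_of_mem hp]
        have := hne p.2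
        generalize zeta q p.2 ^ G.dist o v * (zeta q p.2 - (zeta q p.2)⁻¹) = D at *
        field_simp
        ring
      · rw [Set.indicator_of_notMem (show p ∉ Prod.fst ⁻¹' shadow G o x from hp),
          Set.indicator_of_notMem hp]
        ring
    simp_rw [h]
    rw [integral_sub
      (integrable_continuous_mul (integrable_mul_wavePlus hq hG hg.1 x) F₁)
      (integrable_continuous_mul (integrable_mul_wavePlus hq hG hg.1 v) F₂),
      hg.integral_mul hq hG, hg.integral_mul hq hG, sub_zero]

/-- The indicator of a closed set is a bounded pointwise limit of continuous functions. -/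
theorem Annihilates.setIntegral_prod (hq : 2 ≤ q) (hG : IsHomogeneousTree G q)
    {g : Phase G o q → ℂ} (hg : Annihilates g) (x : V) {C : Set (Set.Icc (0 : ℝ) (tau q))}
    (hC : IsClosed C) : ∫ p in shadow G o x ×ˢ C, g p ∂(phaseMeasure G o q) = 0 := by
  have hE : MeasurableSet (Prod.fst ⁻¹' shadow G o x : Set (Phase G o q)) :=
    measurable_fst (measurableSet_shadow x)
  rw [← MeasureTheory.integral_indicator ((measurableSet_shadow x).prod hC.measurableSet)]
  let F : ℕ → C(Set.Icc (0 : ℝ) (tau q), ℂ) := fun n =>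
    ⟨fun s => ((hC.apprSeq n s : ℝ) : ℂ), by fun_prop⟩
  have hlim : Filter.Tendsto (fun n => ∫ p, (Prod.fst ⁻¹' shadow G o x).indicator
      (fun p => F n p.2 * g p) p ∂(phaseMeasure G o q)) Filter.atTop
      (nhds (∫ p, (shadow G o x ×ˢ C).indicator g p ∂(phaseMeasure G o q))) := by
    refine tendsto_integral_of_dominated_convergence (fun p => ‖g p‖) (fun n => ?_) hg.1.norm
      (fun n => .of_forall fun p => ?_) (.of_forall fun p => ?_)
    · exact ((integrable_continuous_mul hg.1 (F n)).indicator hE).aestronglyMeasurable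
    · refine (norm_indicator_le_norm_self _ _).trans ?_
      rw [norm_mul]
      refine mul_le_of_le_one_left (norm_nonneg _) ?_
      simpa [F] using HasOuterApproxClosed.apprSeq_apply_le_one hC n p.2
    · by_cases hp : p.1 ∈ shadow G o x
      · have h1 := tendsto_pi_nhds.1 (HasOuterApproxClosed.tendsto_apprSeq hC) p.2
        have h2 : Filter.Tendsto (fun n => F n p.2 * g p) Filter.atTop
            (nhds ((((C.indicator (fun _ => (1 : NNReal)) p.2 : NNReal) : ℝ) : ℂ) * g p)) :=
          ((Complex.continuous_ofReal.comp NNReal.continuous_coe).continuousAt.tendsto.comp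
            h1).mul_const _
        convert h2 using 1
        · ext n
          exact Set.indicator_of_mem (show p ∈ Prod.fst ⁻¹' shadow G o x from hp) _
        · congr 1
          by_cases hc : p.2 ∈ C <;> simp [Set.indicator, hp, hc]
      · have h1 : ∀ n, (Prod.fst ⁻¹' shadow G o x).indicator (fun p => F n p.2 * g p) p = 0 :=
          fun n => Set.indicator_of_notMem (show p ∉ Prod.fst ⁻¹' shadow G o x from hp) _
        simp_rw [h1]
        rw [Set.indicator_of_notMem (fun h => hp h.1)]
        exact tendsto_const_nhds
  simp_rw [hg.integral_indicator hq hG] at hlim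
  exact (tendsto_nhds_unique hlim tendsto_const_nhds)

/-- Two sets `E(x)`, `E(y)` that meet are nested, because a vertex of a ray determines all earlier
ones. -/
theorem isPiSystem_shadow (hT : G.IsTree) : IsPiSystem (Set.range (shadow G o)) := by
  rintro _ ⟨x, rfl⟩ _ ⟨y, rfl⟩ hne
  wlog hle : G.dist o x ≤ G.dist o y generalizing x y
  · rw [Set.inter_comm] at hne ⊢
    exact this y x hne (by omega)
  obtain ⟨ω, hx, hy⟩ := hne
  refine ⟨y, (Set.inter_eq_right.2 fun ω' hω' => ?_).symm⟩
  rw [mem_shadow hT] at *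
  refine Eq.trans ?_ hx
  exact ray_eq_of_le hT hle (hω'.trans hy.symm)

/-- Integrals of `g` vanish over rectangles `E(x) × C`, a generating π-system. Integrability
suffices here, which matters because a symbol is not assumed square integrable. -/
theorem Annihilates.ae_eq_zero (hq : 2 ≤ q) (hG : IsHomogeneousTree G q)
    {g : Phase G o q → ℂ} (hg : Annihilates g) : g =ᵐ[phaseMeasure G o q] 0 := by
  have hgen : (inferInstance : MeasurableSpace (Phase G o q)) =
      MeasurableSpace.generateFrom (Set.image2 (· ×ˢ ·) (Set.range (shadow G o))
        {C : Set (Set.Icc (0 : ℝ) (tau q)) | IsClosed C}) := by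
    rw [← generateFrom_prod_eq, ← borel_eq_generateFrom_isClosed, ← BorelSpace.measurable_eq]
    · exact ⟨fun _ => shadow G o o, fun _ => ⟨o, rfl⟩,
        by simp [shadow_root hG.isTree, Set.iUnion_const]⟩
    · exact ⟨fun _ => Set.univ, fun _ => isClosed_univ, Set.iUnion_const _⟩
  have huniv : ∫ p, g p ∂(phaseMeasure G o q) = 0 := by
    have := hg.setIntegral_prod hq hG o isClosed_univ
    rwa [shadow_root hG.isTree, Set.univ_prod_univ, setIntegral_univ] at this
  refine hg.1.ae_eq_zero_of_forall_setIntegral_eq_zero fun s hs _ => ?_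
  clear * - hs hgen huniv hg hq hG
  induction s, hs using MeasurableSpace.induction_on_inter hgen
    ((isPiSystem_shadow hG.isTree).prod isPiSystem_isClosed) with
  | empty => simp
  | basic t ht =>
    obtain ⟨_, ⟨x, rfl⟩, C, hC, rfl⟩ := ht
    exact hg.setIntegral_prod hq hG x hC
  | compl t ht ih => rw [setIntegral_compl ht hg.1, huniv, ih, sub_zero]
  | iUnion f hd hf ih =>
    rw [integral_iUnion hf hd hg.1.integrableOn]
    simp_rw [ih, tsum_zero]

end Totality

/-! ### Unconditional convergence of wave series -/

section Series

theorem orthonormal_waveMinus (hq : 2 ≤ q) (hG : IsHomogeneousTree G q) :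
    Orthonormal ℂ fun x => (memLp_waveMinus (o := o) hq hG x 2).toLp _ := by
  classical
  rw [orthonormal_iff_ite]
  intro x y
  rw [L2.inner_def]
  have h : ∀ᵐ p ∂(phaseMeasure G o q),
      inner ℂ ((memLp_waveMinus hq hG x 2).toLp (fun p => waveMinus p x) p)
        ((memLp_waveMinus hq hG y 2).toLp (fun p => waveMinus p y) p) =
      waveMinus p y * wavePlus p x := by
    filter_upwards [(memLp_waveMinus hq hG x 2).coeFn_toLp,
      (memLp_waveMinus hq hG y 2).coeFn_toLp] with p hx hy
    rw [hx, hy, ← conj_wavePlus hq p x]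
    simp
  rw [integral_congr_ae h, integral_waveMinus_mul_wavePlus hq hG]
  simp only [hG.isTree.connected.dist_eq_zero_iff]

theorem memLp_sum_waveMinus (hq : 2 ≤ q) (hG : IsHomogeneousTree G q) (a : V → ℂ) (F : Finset V) :
    MemLp (fun p : Phase G o q => ∑ x ∈ F, waveMinus p x * a x) 2 (phaseMeasure G o q) :=
  memLp_finsetSum F fun x _ => (memLp_waveMinus hq hG x 2).mul_const (a x)

theorem toLp_sum_waveMinus (hq : 2 ≤ q) (hG : IsHomogeneousTree G q) (a : V → ℂ) (F : Finset V) :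
    (memLp_sum_waveMinus (o := o) hq hG a F).toLp _ =
      ∑ x ∈ F, a x • (memLp_waveMinus hq hG x 2).toLp _ := by
  have h1 : ∀ᵐ p ∂(phaseMeasure G o q), ∀ x ∈ F,
      (a x • (memLp_waveMinus hq hG x 2).toLp (fun p => waveMinus p x) : Lp ℂ 2 _) p =
        waveMinus p x * a x := by
    refine (ae_ball_iff F.countable_toSet).2 fun x _ => ?_
    filter_upwards [Lp.coeFn_smul (a x) ((memLp_waveMinus hq hG x 2).toLp fun p => waveMinus p x),
      (memLp_waveMinus hq hG x 2).coeFn_toLp] with p h h'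
    rw [h, Pi.smul_apply, h', smul_eq_mul, mul_comm]
  refine Lp.ext ?_
  filter_upwards [(memLp_sum_waveMinus hq hG a F).coeFn_toLp, h1, Lp.coeFn_finsetSum F
    (fun x => a x • (memLp_waveMinus hq hG x 2).toLp (fun p => waveMinus p x))] with p h h' h''
  rw [h, h'', Finset.sum_apply]
  exact Finset.sum_congr rfl fun x hx => (h' x hx).symm

/-- The series `∑ x, a x * q ^ ((1/2 - i s) h_ω(x))` with square summable coefficients converges
unconditionally in `L²(Ω × [0, τ])`. -/
theorem exists_tendsto_sum_waveMinus (hq : 2 ≤ q) (hG : IsHomogeneousTree G q) {a : V → ℂ}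
    (ha : Summable fun x => ‖a x‖ ^ 2) :
    ∃ g : Phase G o q → ℂ, Measurable g ∧ MemLp g 2 (phaseMeasure G o q) ∧
      (∀ x, ∫ p, g p * wavePlus p x ∂(phaseMeasure G o q) = a x) ∧
      Filter.Tendsto (fun F : Finset V => eLpNorm
        ((fun p => ∑ x ∈ F, waveMinus p x * a x) - g) 2 (phaseMeasure G o q))
        Filter.atTop (nhds 0) := by
  classical
  have hW := orthonormal_waveMinus (o := o) hq hG
  set W := fun x => (memLp_waveMinus (o := o) hq hG x 2).toLp _ with hWdef
  have hsum : Summable fun x => a x • W x :=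
    (hW.orthogonalFamily.summable_iff_norm_sq_summable a).2 ha
  obtain ⟨g, hg⟩ := hsum
  refine ⟨g, (Lp.stronglyMeasurable g).measurable, Lp.memLp g, fun x => ?_, ?_⟩
  · have h1 : HasSum (fun y => inner ℂ (W x) (a y • W y)) (inner ℂ (W x) g) :=
      hg.mapL (innerSL ℂ (W x))
    have h2 : inner ℂ (W x) g = a x := by
      refine h1.unique ?_
      simp_rw [inner_smul_right, orthonormal_iff_ite.1 hW, mul_ite, mul_one, mul_zero]
      convert hasSum_ite_eq x (a x) using 2 with y
      by_cases h : y = x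
      · simp [h]
      · simp [h, Ne.symm h]
    rw [← h2, L2.inner_def]
    refine integral_congr_ae ?_
    filter_upwards [(memLp_waveMinus hq hG x 2).coeFn_toLp] with p hp
    rw [hp, ← conj_wavePlus hq p x]
    simp
  · rw [← Lp.tendsto_Lp_iff_tendsto_eLpNorm'' _ (memLp_sum_waveMinus hq hG a) _ (Lp.memLp g)]
    simp_rw [toLp_sum_waveMinus hq hG, Lp.toLp_coeFn]
    exact hg

end Series

/-! ### Symbols and matrix entries -/

section Symbols

theorem helgason_single [DecidableEq V] (y : V) (p : Phase G o q) :
    helgason ((lp.single 2 y (1 : ℂ) : L2 V) : V → ℂ) p = wavePlus p y := by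
  rw [helgason, finsum_eq_single _ y]
  · rw [lp.single_apply_self, one_mul]
  · intro x hx
    rw [lp.single_apply_ne _ _ _ hx, zero_mul]

theorem eq_sum_single [DecidableEq V] (f : L2 V)
    (hf : (Function.support (f : V → ℂ)).Finite) :
    f = ∑ y ∈ hf.toFinset, f y • (lp.single 2 y (1 : ℂ) : L2 V) := by
  ext x
  rw [lp.coeFn_sum, Finset.sum_apply]
  simp only [lp.coeFn_smul, Pi.smul_apply, lp.single_apply, smul_eq_mul, Pi.single_apply, mul_ite,
    mul_one, mul_zero, Finset.sum_ite_eq, Set.Finite.mem_toFinset, Function.mem_support]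
  by_cases h : f x = 0 <;> simp [h]

/-- A symbol is determined by its action on the unit vectors of `L²(𝔛)`. -/
theorem isPseudoDiff_iff [DecidableEq V] (σ : V → Phase G o q → ℂ) (T : L2 V →L[ℂ] L2 V) :
    IsPseudoDiff σ T ↔ ∀ x y,
      Integrable (fun p => waveMinus p x * σ x p * wavePlus p y) (phaseMeasure G o q) ∧
      T (lp.single 2 y 1) x =
        ∫ p, waveMinus p x * σ x p * wavePlus p y ∂(phaseMeasure G o q) := by
  constructor
  · intro h x y
    have := h (lp.single 2 y 1) ((Set.finite_singleton y).subset fun z hz => ?_) x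
    · simpa only [helgason_single] using this
    · by_contra hne
      exact hz (lp.single_apply_ne _ _ _ hne)
  · intro h f hf x
    have h1 : ∀ p, waveMinus p x * σ x p * helgason (f : V → ℂ) p =
        ∑ y ∈ hf.toFinset, f y * (waveMinus p x * σ x p * wavePlus p y) := by
      intro p
      rw [helgason, finsum_eq_sum_of_support_subset (s := hf.toFinset), Finset.mul_sum]
      · exact Finset.sum_congr rfl fun y _ => by ring
      · intro y hy
        rw [Set.Finite.coe_toFinset]
        exact left_ne_zero_of_mul hy
    simp_rw [h1]
    refine ⟨integrable_finsetSum _ fun y _ => (h x y).1.const_mul _, ?_⟩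
    rw [integral_finsetSum _ fun y _ => (h x y).1.const_mul _]
    conv_lhs => rw [eq_sum_single f hf]
    rw [map_sum, lp.coeFn_sum, Finset.sum_apply]
    refine Finset.sum_congr rfl fun y _ => ?_
    rw [integral_const_mul, ← (h x y).2, map_smul]
    rfl

theorem adjoint_single_apply [DecidableEq V] (T : L2 V →L[ℂ] L2 V) (x y : V) :
    ContinuousLinearMap.adjoint T (lp.single 2 x 1) y =
      (starRingEnd ℂ) (T (lp.single 2 y 1) x) := by
  have h := ContinuousLinearMap.adjoint_inner_right T (lp.single 2 y (1 : ℂ)) (lp.single 2 x 1)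
  rw [lp.inner_single_left, lp.inner_single_right] at h
  simpa using h

theorem summable_norm_sq (f : L2 V) : Summable fun x => ‖f x‖ ^ 2 := by
  have := (lp.memℓp f).summable (by norm_num)
  simpa using this

end Symbols

/-! ### Symbols as limits of series -/

section Adjoint

theorem ae_eq_of_coefficients (hq : 2 ≤ q) (hG : IsHomogeneousTree G q) {f g : Phase G o q → ℂ}
    (hf : Integrable f (phaseMeasure G o q)) (hg : Integrable g (phaseMeasure G o q))
    (h : ∀ x, ∫ p, f p * wavePlus p x ∂(phaseMeasure G o q) =
      ∫ p, g p * wavePlus p x ∂(phaseMeasure G o q)) :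
    f =ᵐ[phaseMeasure G o q] g := by
  have h0 : Annihilates (f - g) := by
    refine ⟨hf.sub hg, fun x => ?_⟩
    simp_rw [Pi.sub_apply, sub_mul]
    rw [integral_sub (integrable_mul_wavePlus hq hG hf x) (integrable_mul_wavePlus hq hG hg x), h,
      sub_self]
  filter_upwards [h0.ae_eq_zero hq hG] with p hp
  exact sub_eq_zero.1 hp

/-- A function `σ` is a section of a symbol with coefficients `a` if and only if it is the limit of
the associated series. -/
theorem coefficients_iff_tendsto (hq : 2 ≤ q) (hG : IsHomogeneousTree G q) {a : V → ℂ} {y : V}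
    {σ g : Phase G o q → ℂ} (hσ : Measurable σ) (hgm : Measurable g)
    (hg : MemLp g 2 (phaseMeasure G o q))
    (hga : ∀ x, ∫ p, g p * wavePlus p x ∂(phaseMeasure G o q) = a x)
    (hlim : Filter.Tendsto (fun F : Finset V => eLpNorm
        ((fun p => ∑ x ∈ F, waveMinus p x * a x) - g) 2 (phaseMeasure G o q))
        Filter.atTop (nhds 0)) :
    (∀ x, Integrable (fun p => waveMinus p y * σ p * wavePlus p x) (phaseMeasure G o q) ∧
      a x = ∫ p, waveMinus p y * σ p * wavePlus p x ∂(phaseMeasure G o q)) ↔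
    Filter.Tendsto (fun F : Finset V => eLpNorm
      (fun p => σ p - (waveMinus p y)⁻¹ * ∑ x ∈ F, waveMinus p x * a x) 2 (phaseMeasure G o q))
      Filter.atTop (nhds 0) := by
  have := isFiniteMeasure_phaseMeasure (o := o) hq hG
  have hgi : Integrable g (phaseMeasure G o q) := hg.integrable one_le_two
  have hwσ : Measurable fun p => waveMinus p y * σ p := (measurable_waveMinus hG y).mul hσ
  have hne := fun p : Phase G o q => waveMinus_ne_zero hq p y
  have hzero : ∀ {c : ENNReal} {u : Finset V → ENNReal}, c ≠ ⊤ →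
      Filter.Tendsto u Filter.atTop (nhds 0) →
      Filter.Tendsto (fun F => c * u F) Filter.atTop (nhds 0) := by
    intro c u hc hu
    simpa using ENNReal.Tendsto.const_mul hu (Or.inr hc)
  -- Both conditions mean this equality: the first by uniqueness of coefficients in `L¹`, the second
  -- because `waveMinus · y` and its inverse are bounded by `√q ^ |y|`.
  trans (fun p => waveMinus p y * σ p) =ᵐ[phaseMeasure G o q] g
  · constructor
    · intro h
      refine ae_eq_of_coefficients hq hG ?_ hgi fun x => by rw [hga, (h x).2]
      -- The wave at `o` is constantly `1`, so the condition at `x = o` is integrability of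
      -- `waveMinus · y * σ` itself.
      simpa [wavePlus_eq, height_root hG.isTree] using (h o).1
    · intro h x
      have h1 : (fun p => waveMinus p y * σ p * wavePlus p x) =ᵐ[phaseMeasure G o q]
          fun p => g p * wavePlus p x := by
        filter_upwards [h] with p hp
        rw [hp]
      exact ⟨(integrable_mul_wavePlus hq hG hgi x).congr h1.symm, by
        rw [integral_congr_ae h1, hga]⟩
  · constructor
    · intro h
      refine tendsto_of_tendsto_of_tendsto_of_le_of_le tendsto_const_nhds
        (hzero (c := ENNReal.ofReal (Real.sqrt q ^ G.dist o y)) (by simp) hlim)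
        (fun _ => zero_le) fun F => eLpNorm_le_mul_eLpNorm_of_ae_le_mul ?_ 2
      filter_upwards [h] with p hp
      have h1 : σ p - (waveMinus p y)⁻¹ * ∑ x ∈ F, waveMinus p x * a x =
          -((waveMinus p y)⁻¹ * (∑ x ∈ F, waveMinus p x * a x - g p)) := by
        rw [← hp]
        have := hne p
        field_simp
        ring
      rw [h1, norm_neg, norm_mul]
      exact mul_le_mul_of_nonneg_right (norm_inv_waveMinus_le hq p y) (norm_nonneg _)
    · intro h
      have h1 := (hzero (c := ENNReal.ofReal (Real.sqrt q ^ G.dist o y)) (by simp) h).add hlim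
      rw [add_zero] at h1
      -- The left side does not depend on `F`; comparing through the partial sums bounds it by a
      -- quantity that tends to zero.
      have h2 : eLpNorm ((fun p => waveMinus p y * σ p) - g) 2 (phaseMeasure G o q) ≤ 0 := by
        refine ge_of_tendsto' h1 fun F => ?_
        have h3 : (fun p => waveMinus p y * σ p) - g =
            (fun p => waveMinus p y *
              (σ p - (waveMinus p y)⁻¹ * ∑ x ∈ F, waveMinus p x * a x)) +
            ((fun p => ∑ x ∈ F, waveMinus p x * a x) - g) := by
          ext p
          simp only [Pi.sub_apply, Pi.add_apply, mul_sub, mul_inv_cancel_left₀ (hne p)]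
          ring
        have hS : Measurable fun p : Phase G o q => ∑ x ∈ F, waveMinus p x * a x :=
          Finset.measurable_fun_sum _ fun x _ => (measurable_waveMinus hG x).mul_const _
        have hw := measurable_waveMinus (o := o) hG y
        rw [h3]
        refine (eLpNorm_add_le ?_ ?_ one_le_two).trans (add_le_add_left ?_ _)
        · exact (hw.mul (hσ.sub (hw.inv.mul hS))).aestronglyMeasurable
        · exact (hS.sub hgm).aestronglyMeasurable
        · refine eLpNorm_le_mul_eLpNorm_of_ae_le_mul (.of_forall fun p => ?_) 2
          rw [norm_mul]
          exact mul_le_mul_of_nonneg_right (norm_waveMinus_le hq p y) (norm_nonneg _)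
      have h4 := (eLpNorm_eq_zero_iff (hwσ.sub hgm).aestronglyMeasurable two_ne_zero).1
        (le_zero_iff.1 h2)
      filter_upwards [h4] with p hp
      exact sub_eq_zero.1 hp

end Adjoint

end HomTree

end

/-- Symbols are functions of a vertex and of a point of `Ω × [0, τ]`; since the vertex set is
countable and discrete, a symbol is measurable when all its sections `σ x` are. The series over the
vertices is understood as that of the Fourier-Helgason transform on `L²(𝔛)`: its finite partial
sums converge, for every `y`, in `L²(Ω × [0, τ], ν ⊗ μ)`. -/
theorem mainTheorem10 {V : Type*} (G : SimpleGraph V) (o : V) (q : ℕ) (hq : 2 ≤ q)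
    (hG : HomTree.IsHomogeneousTree G q)
    (σ : V → HomTree.Phase G o q → ℂ) (hσ : ∀ x, Measurable (σ x))
    (T : HomTree.L2 V →L[ℂ] HomTree.L2 V)
    (hT : HomTree.IsPseudoDiff σ T) (hnuc : HomTree.IsNuclear T) :
    (∃ σ' : V → HomTree.Phase G o q → ℂ, (∀ x, Measurable (σ' x)) ∧
      HomTree.IsPseudoDiff σ' (ContinuousLinearMap.adjoint T)) ∧
    ∀ σ' : V → HomTree.Phase G o q → ℂ, (∀ x, Measurable (σ' x)) →
      (HomTree.IsPseudoDiff σ' (ContinuousLinearMap.adjoint T) ↔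
        ∀ y : V, Filter.Tendsto
          (fun F : Finset V => eLpNorm
            (fun p₁ : HomTree.Phase G o q => σ' y p₁ -
              (HomTree.waveMinus p₁ y)⁻¹ * ∑ x ∈ F, HomTree.waveMinus p₁ x *
                ∫ p, (starRingEnd ℂ) (σ x p) * HomTree.wavePlus p x * HomTree.waveMinus p y
                  ∂(HomTree.phaseMeasure G o q))
            2 (HomTree.phaseMeasure G o q))
          Filter.atTop (nhds 0)) := by
  classical
  -- Conjugation exchanges the two kinds of waves, so the inner integral is the conjugate of a
  -- matrix entry of `T`.
  have hcoef : ∀ x y, ∫ p, (starRingEnd ℂ) (σ x p) * HomTree.wavePlus p x * HomTree.waveMinus p y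
      ∂(HomTree.phaseMeasure G o q) =
        ContinuousLinearMap.adjoint T (lp.single 2 x 1) y := by
    intro x y
    rw [HomTree.adjoint_single_apply, ((HomTree.isPseudoDiff_iff σ T).1 hT x y).2, ← integral_conj]
    refine integral_congr_ae (.of_forall fun p => ?_)
    simp only [← HomTree.conj_wavePlus hq, map_mul, Complex.conj_conj]
    ring
  simp_rw [hcoef]
  -- For fixed `y` these are the conjugate entries of the vector `T δ_y` in `L²(𝔛)`.
  have hsum : ∀ y, Summable fun x =>
      ‖ContinuousLinearMap.adjoint T (lp.single 2 x 1) y‖ ^ 2 := by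
    intro y
    simpa only [HomTree.adjoint_single_apply, RCLike.norm_conj] using
      HomTree.summable_norm_sq (T (lp.single 2 y 1))
  choose g hgm hg hga hlim using fun y =>
    HomTree.exists_tendsto_sum_waveMinus (o := o) hq hG (hsum y)
  have hiff : ∀ σ' : V → HomTree.Phase G o q → ℂ, (∀ x, Measurable (σ' x)) →
      (HomTree.IsPseudoDiff σ' (ContinuousLinearMap.adjoint T) ↔ _) := fun σ' hσ' =>
    (HomTree.isPseudoDiff_iff σ' (ContinuousLinearMap.adjoint T)).trans
      (forall_congr' fun y => HomTree.coefficients_iff_tendsto hq hG (hσ' y) (hgm y) (hg y)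
        (hga y) (hlim y))
  refine ⟨⟨fun y p => (HomTree.waveMinus p y)⁻¹ * g y p, ?_, ?_⟩, hiff⟩
  · exact fun y => (HomTree.measurable_waveMinus hG y).inv.mul (hgm y)
  · refine (HomTree.isPseudoDiff_iff _ _).2 fun y x => ?_
    simp_rw [mul_inv_cancel_left₀ (HomTree.waveMinus_ne_zero hq _ y)]
    have := HomTree.isFiniteMeasure_phaseMeasure (o := o) hq hG
    exact ⟨HomTree.integrable_mul_wavePlus hq hG ((hg y).integrable one_le_two) x,
      (hga y x).symm⟩
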